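/- Let $L_p$ ($1\le p<\infty$) be the space of $2\pi$-periodic measurable functions with $\|f\|_p=\big(\int_0^{2\pi}|f(t)|^p\,dt\big)^{1/p}<\infty$, and for $f\in L_1$ put $\hat f(k)=\frac1{2\pi}\int_{-\pi}^{\pi}f(t)e^{-ikt}\,dt$. For $\alpha>0$, $r\in(0,1)$ and $\beta\in\mathbb{R}$ put $\psi(k)=\exp(-\alpha k^r)$, $k\in\mathbb{N}$, and let $L^{\alpha,r}_{\beta,1}$ be the class of all real-valued $f\in L_1$ for which $$\sum_{k\in\mathbb{Z}\setminus\{0\}}\frac{\hat f(k)}{\psi(|k|)}\,e^{i(kx+\frac{\beta\pi}{2}\operatorname{sign}k)}$$ is the Fourier series of a real-valued function $\varphi\in L_1$ with $\|\varphi\|_1\le1$ (and thus $\int_{0}^{2\pi}\varphi(t)\,dt=0$). For $m\in\mathbb{N}$ and $1<s<\infty$ set $$e^{\bot}_m(L^{\alpha,r}_{\beta,1})_s=\sup_{f\in L^{\alpha,r}_{\beta,1}}\ \inf_{\gamma_m}\Big\|f(\cdot)-\sum_{k\in\gamma_m}\hat f(k)e^{ik\,\cdot}\Big\|_s,$$ where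 the infimum is over all sets $\gamma_m$ of $m$ integers. Write $a_n\asymp b_n$ if there are constants $C_1,C_2>0$ independent of $n$ such that $C_1a_n\le b_n\le C_2a_n$ for all $n\in\mathbb{N}=\{1,2,\dots\}$. Let $r\in(0,1)$, $\alpha>0$, $1<s<\infty$, $\frac1s+\frac1{s'}=1$ and $\beta\in\mathbb{R}$. Then $$e^{\bot}_{2n-1}(L^{\alpha,r}_{\beta,1})_s\asymp e^{\bot}_{2n}(L^{\alpha,r}_{\beta,1})_s\asymp \exp(-\alpha n^r)\,n^{\frac{1-r}{s'}}.$$ -/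

import Mathlib

open MeasureTheory
open scoped Real ENNReal NNReal

namespace OrthApprox

/-- The circle `ℝ / 2πℤ`; functions on it are the `2π`-periodic functions on `ℝ`. Its `volume` is
Lebesgue measure on a period, of total mass `2π`. -/
abbrev Circle2Pi : Type := AddCircle (2 * π)

instance fact_two_pi_pos : Fact (0 < 2 * π) := ⟨Real.two_pi_pos⟩

/-- The Fourier coefficient `(2π)⁻¹ ∫_{-π}^{π} f(t) e^{-ikt} dt` of a real-valued periodic function. -/
noncomputable def coeff (f : Circle2Pi → ℝ) (k : ℤ) : ℂ :=
  fourierCoeff (fun x => (f x : ℂ)) k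

/-- `φ` is a `(ψ, β)`-derivative of `f`: it is summable, and
`∑_{k ≠ 0} (f̂(k) / ψ(|k|)) e^{i (k x + (βπ/2) sign k)}` is its Fourier series. -/
def IsPsiBetaDeriv (ψ : ℕ → ℝ) (β : ℝ) (f φ : Circle2Pi → ℝ) : Prop :=
  MemLp φ 1 volume ∧
    ∀ k : ℤ, coeff φ k =
      if k = 0 then 0
      else coeff f k / (ψ k.natAbs : ℂ) *
        Complex.exp (Complex.I * ((β * π / 2 * (k.sign : ℝ) : ℝ) : ℂ))

/-- The class `L^ψ_{β,p}`: summable `f` having a `(ψ, β)`-derivative `φ` with `φ ∈ L_p`,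
`‖φ‖_p ≤ 1` and `φ ⊥ 1`. -/
def psiBetaClass (ψ : ℕ → ℝ) (β : ℝ) (p : ℝ≥0∞) : Set (Circle2Pi → ℝ) :=
  {f | MemLp f 1 volume ∧ ∃ φ : Circle2Pi → ℝ, IsPsiBetaDeriv ψ β f φ ∧
    MemLp φ p volume ∧ eLpNorm φ p volume ≤ 1 ∧ ∫ x, φ x = 0}

/-- The class `L^{α,r}_{β,p}`, generated by `ψ(t) = exp (-α t^r)`. -/
def expClass (α r β : ℝ) (p : ℝ≥0∞) : Set (Circle2Pi → ℝ) :=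
  psiBetaClass (fun k => Real.exp (-α * (k : ℝ) ^ r)) β p

/-- The partial sum `∑_{k ∈ γ} f̂(k) e^{ikx}`. -/
noncomputable def partialSum (γ : Finset ℤ) (f : Circle2Pi → ℝ) (x : Circle2Pi) : ℂ :=
  ∑ k ∈ γ, coeff f k * fourier k x

/-- The best orthogonal trigonometric approximation `e^⊥_m(f)_s`: the infimum of
`‖f - S_γ(f)‖_s` over all sets `γ` of `m` integers. -/
noncomputable def bestOrth (m : ℕ) (f : Circle2Pi → ℝ) (s : ℝ≥0∞) : ℝ≥0∞ :=
  ⨅ (γ : Finset ℤ) (_ : γ.card = m), eLpNorm (fun x => (f x : ℂ) - partialSum γ f x) s volume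

/-- `e^⊥_m(F)_s`, the supremum of `e^⊥_m(f)_s` over `f ∈ F`. -/
noncomputable def bestOrthClass (m : ℕ) (F : Set (Circle2Pi → ℝ)) (s : ℝ≥0∞) : ℝ≥0∞ :=
  ⨆ f ∈ F, bestOrth m f s

/-- `a_n ≍ b_n`: there are positive constants `C₁`, `C₂` independent of `n` with
`C₁ a_n ≤ b_n ≤ C₂ a_n` for all `n = 1, 2, …`. -/
def SameOrder (a b : ℕ → ℝ≥0∞) : Prop :=
  ∃ C₁ C₂ : ℝ≥0, 0 < C₁ ∧ 0 < C₂ ∧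
    ∀ n : ℕ, 1 ≤ n → (C₁ : ℝ≥0∞) * a n ≤ b n ∧ b n ≤ (C₂ : ℝ≥0∞) * a n

end OrthApprox

namespace OrthApprox

open Filter Topology

/-! ### Uniqueness of Fourier coefficients -/

/-! Write `ψ(k) = exp(-α k^r)`. Near `n` it falls by a constant factor over a block of about
`n^(1-r)` frequencies, and both bounds rest on this.

Upper bound: take for `γ` the frequencies `|k| < n`. The remainder is a convolution of `φ` with the
tail kernel `∑_{|k| ≥ n} ψ(|k|) e^{ikx}`, up to a constant phase on each half-line, so its `L_s`
norm is at most that of the two half-kernels. Each half-kernel is `O(ψ(n) n^(1-r))` in modulus, by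
summing `ψ`, and `O(ψ(n) / |x|)`, by Abel summation. A function of height `A N` that decays like `A
/ |x|` has `L_s` norm `O(A N^(1-1/s))` (`exists_eLpNorm_le_of_kernel_bound`).

Lower bound: let the derivative of `f` be the normalised mean-zero part of a Fejér kernel, and put
`N = n + ⌈n^(1-r)⌉`. A set of at most `2n` frequencies misses at least `n^(1-r)` of `1, …, N` or of
`-1, …, -N`. Pairing the remainder with `∑_{k ≤ N} ψ(k)⁻¹ e^{∓ikx}` cancels `ψ`, so each missed
frequency contributes at least `1/(8π)`, all with one phase. Hölder's inequality divides the total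
by the `L_{s'}` norm of the test polynomial. By the same kernel estimate that norm is `O(ψ(n)⁻¹
n^((1-r)/s))`, since `ψ(N)` and `ψ(n)` are comparable. -/

/-- Pairing with `h` is bounded in the sup norm, so its kernel is closed; it contains the
exponentials, whose span is dense. -/
theorem integral_continuousMap_mul_eq_zero_of_fourierCoeff_eq_zero {T : ℝ} [hT : Fact (0 < T)]
    {h : AddCircle T → ℂ} (hi : Integrable h AddCircle.haarAddCircle)
    (h0 : ∀ n, fourierCoeff h n = 0) (g : C(AddCircle T, ℂ)) :
    ∫ x, g x * h x ∂AddCircle.haarAddCircle = 0 := by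
  have hint : ∀ g : C(AddCircle T, ℂ),
      Integrable (fun x => g x * h x) AddCircle.haarAddCircle := fun g =>
    hi.bdd_mul g.continuous.aestronglyMeasurable (ae_of_all _ g.norm_coe_le_norm)
  let L : C(AddCircle T, ℂ) →L[ℂ] ℂ := LinearMap.mkContinuous
    { toFun := fun g => ∫ x, g x * h x ∂AddCircle.haarAddCircle
      map_add' := fun g₁ g₂ => by
        rw [← integral_add (hint g₁) (hint g₂)]
        simp [add_mul]
      map_smul' := fun c g => by
        simp [← integral_const_mul, mul_assoc] }
    (∫ x, ‖h x‖ ∂AddCircle.haarAddCircle) (fun g => by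
      refine (norm_integral_le_integral_norm _).trans ?_
      rw [mul_comm, ← integral_const_mul]
      refine integral_mono (hint g).norm (hi.norm.const_mul _) fun x => ?_
      simp only [norm_mul]
      gcongr
      exact g.norm_coe_le_norm x)
  have hle : Submodule.span ℂ (Set.range (@fourier T)) ≤ L.ker := by
    rw [Submodule.span_le]
    rintro _ ⟨n, rfl⟩
    have := h0 (-n)
    simp only [fourierCoeff, neg_neg, smul_eq_mul] at this
    exact this
  have hcl := Submodule.topologicalClosure_minimal _ hle L.isClosed_ker
  rw [span_fourier_closure_eq_top] at hcl
  exact hcl (Submodule.mem_top (x := g))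

/-- A summable function on the circle whose Fourier coefficients all vanish is zero. -/
theorem ae_eq_zero_of_fourierCoeff_eq_zero {T : ℝ} [hT : Fact (0 < T)]
    {h : AddCircle T → ℂ} (hi : Integrable h AddCircle.haarAddCircle)
    (h0 : ∀ n, fourierCoeff h n = 0) : h =ᵐ[AddCircle.haarAddCircle] 0 := by
  refine ae_eq_zero_of_forall_setIntegral_isClosed_eq_zero hi fun s hs => ?_
  -- The indicator of a closed set is a pointwise limit of continuous functions bounded by `1`, so
  -- dominated convergence carries the vanishing over to set integrals.
  have hlim : Tendsto (fun n => ∫ x, ((hs.apprSeq n x : ℝ) : ℂ) * h x ∂AddCircle.haarAddCircle)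
      atTop (𝓝 (∫ x, s.indicator h x ∂AddCircle.haarAddCircle)) := by
    refine tendsto_integral_of_dominated_convergence (fun x => ‖h x‖) (fun n => ?_) hi.norm
      (fun n => ae_of_all _ fun x => ?_) (ae_of_all _ fun x => ?_)
    · refine AEStronglyMeasurable.mul ?_ hi.1
      have : Continuous fun x => ((hs.apprSeq n x : ℝ) : ℂ) := by fun_prop
      exact this.aestronglyMeasurable
    · rw [norm_mul]
      refine mul_le_of_le_one_left (norm_nonneg _) ?_
      have := HasOuterApproxClosed.apprSeq_apply_le_one hs n x
      simpa using this
    · have := tendsto_pi_nhds.1 (HasOuterApproxClosed.tendsto_apprSeq hs) x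
      have h2 : Tendsto (fun n => ((hs.apprSeq n x : ℝ) : ℂ) * h x) atTop
          (𝓝 ((((s.indicator (fun _ => (1 : ℝ≥0)) x : ℝ≥0) : ℝ) : ℂ) * h x)) :=
        ((Complex.continuous_ofReal.comp NNReal.continuous_coe).tendsto _ |>.comp this).mul_const _
      convert h2 using 2
      by_cases hx : x ∈ s <;> simp [hx]
  have hz : ∀ n, ∫ x, ((hs.apprSeq n x : ℝ) : ℂ) * h x ∂AddCircle.haarAddCircle = 0 := fun n =>
    integral_continuousMap_mul_eq_zero_of_fourierCoeff_eq_zero hi h0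
      ⟨fun x => ((hs.apprSeq n x : ℝ) : ℂ), by fun_prop⟩
  simp only [hz] at hlim
  rw [← integral_indicator hs.measurableSet]
  exact tendsto_nhds_unique hlim tendsto_const_nhds

/-- A summable function on the circle with absolutely summable Fourier coefficients is almost
everywhere the sum of its Fourier series. -/
theorem ae_hasSum_fourier_of_summable {T : ℝ} [hT : Fact (0 < T)]
    {h : AddCircle T → ℂ} (hi : Integrable h AddCircle.haarAddCircle)
    (hs : Summable (fourierCoeff h)) :
    ∀ᵐ x ∂AddCircle.haarAddCircle, HasSum (fun n => fourierCoeff h n * fourier n x) (h x) := by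
  have hsum : Summable fun n => fourierCoeff h n • (fourier n : C(AddCircle T, ℂ)) := by
    refine Summable.of_norm ?_
    simpa [norm_smul, fourier_norm] using hs.norm
  -- The series converges uniformly to a continuous `F`. Each Fourier coefficient is a bounded
  -- functional, so `F` has the coefficients of `h`, and uniqueness gives `h = F` almost everywhere.
  set F : C(AddCircle T, ℂ) := ∑' n, fourierCoeff h n • (fourier n : C(AddCircle T, ℂ)) with hF
  have hpt : ∀ x, HasSum (fun n => fourierCoeff h n * fourier n x) (F x) := fun x => by
    have := (ContinuousMap.hasSum_apply hsum.hasSum x)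
    simpa using this
  have hFi : Integrable F AddCircle.haarAddCircle :=
    F.continuous.integrable_of_hasCompactSupport (HasCompactSupport.of_compactSpace _)
  have hcoef : ∀ m, fourierCoeff F m = fourierCoeff h m := fun m => by
    let L : C(AddCircle T, ℂ) →L[ℂ] ℂ := LinearMap.mkContinuous
      { toFun := fun g => fourierCoeff g m
        map_add' := fun g₁ g₂ => by
          have h1 : ∀ g : C(AddCircle T, ℂ), Integrable g AddCircle.haarAddCircle := fun g =>
            g.continuous.integrable_of_hasCompactSupport (HasCompactSupport.of_compactSpace _)
          exact congrFun (fourierCoeff.add (h1 g₁) (h1 g₂)) m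
        map_smul' := fun c g => by
          simpa using fourierCoeff.const_smul (g : AddCircle T → ℂ) c m } 1 (fun g => by
        refine (norm_integral_le_of_norm_le_const (C := ‖g‖) (ae_of_all _ fun x => ?_)).trans ?_
        · rw [norm_smul]
          have : ‖(fourier (-m) : C(AddCircle T, ℂ)) x‖ = 1 := Circle.norm_coe _
          rw [this, one_mul]
          exact g.norm_coe_le_norm x
        · simp)
    have h1 : HasSum (fun n => L (fourierCoeff h n • (fourier n : C(AddCircle T, ℂ)))) (L F) :=
      L.hasSum hsum.hasSum
    have h2 : ∀ n, L (fourierCoeff h n • (fourier n : C(AddCircle T, ℂ)))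
        = if n = m then fourierCoeff h m else 0 := fun n => by
      rw [map_smul]
      change _ • fourierCoeff (fourier n : C(AddCircle T, ℂ)) m = _
      rw [fourierCoeff_fourier]
      by_cases hn : n = m
      · subst hn; simp
      · simp [hn, Ne.symm hn]
    simp only [h2] at h1
    exact h1.unique (hasSum_ite_eq m _)
  have hz := ae_eq_zero_of_fourierCoeff_eq_zero (hi.sub hFi) (fun n => by
    have := congrFun (fourierCoeff.add hi (hFi.const_mul (-1 : ℂ))) n
    have h3 := fourierCoeff.const_mul (F : AddCircle T → ℂ) (-1) n
    have : fourierCoeff (h - ⇑F) n = fourierCoeff h n + fourierCoeff (fun x => -1 * F x) n := by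
      rw [← Pi.add_apply, ← this]
      congr 1
      ext x
      simp [sub_eq_add_neg]
    rw [this, h3, hcoef]
    ring)
  filter_upwards [hz] with x hx
  have : h x = F x := by simpa [sub_eq_zero] using hx
  rw [this]
  exact hpt x

/-! ### The `L_q`-norm of a kernel concentrated near the origin -/

/-- The norm equals `2 |sin (t/2)|`, and Jordan's inequality bounds the sine from below. -/
theorem abs_le_norm_one_sub_fourier {ε : ℤ} (hε : ε = 1 ∨ ε = -1) {t : ℝ} (ht : |t| ≤ π) :
    2 / π * |t| ≤ ‖1 - (fourier ε : C(Circle2Pi, ℂ)) (t : Circle2Pi)‖ := by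
  have h1 : ‖1 - (fourier ε : C(Circle2Pi, ℂ)) (t : Circle2Pi)‖ = 2 * |Real.sin (t / 2)| := by
    have hπ : (π : ℂ) ≠ 0 := by exact_mod_cast Real.pi_ne_zero
    have key : ∀ u : ℝ, ‖1 - Complex.exp (Complex.I * u)‖ = 2 * |Real.sin (u / 2)| := fun u => by
      rw [norm_sub_rev, Complex.norm_exp_I_mul_ofReal_sub_one]
      simp
    rw [fourier_coe_apply]
    rcases hε with rfl | rfl
    · rw [← key]; congr 3; push_cast; field_simp
    · have := key (-t)
      rw [neg_div, Real.sin_neg, abs_neg] at this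
      rw [← this]; congr 3; push_cast; field_simp
  rw [h1]
  have h2 : |t / 2| ≤ π / 2 := by rw [abs_div, abs_two]; linarith
  have := Real.mul_abs_le_abs_sin h2
  rw [abs_div, abs_two] at this
  have e : 2 / π * |t| = 2 * (2 / π * (|t| / 2)) := by ring
  rw [e]
  linarith

/-- If `|h| ≤ A N` and `|1 - e^{±ix}| |h| ≤ A`, then `‖h‖_q = O(A N^{1 - 1/q})`. -/
theorem exists_eLpNorm_le_of_kernel_bound {q : ℝ} (hq : 1 < q) :
    ∃ C : ℝ, 0 < C ∧ ∀ (ε : ℤ) (h : Circle2Pi → ℂ) (A N : ℝ), (ε = 1 ∨ ε = -1) → 0 ≤ A → 0 < N →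
      (∀ x, ‖h x‖ ≤ A * N) →
      (∀ x, ‖1 - (fourier ε : C(Circle2Pi, ℂ)) x‖ * ‖h x‖ ≤ A) →
      eLpNorm h (ENNReal.ofReal q) volume ≤ ENNReal.ofReal (C * (A * N ^ (1 - 1 / q))) := by
  have hq0 : 0 < q := by linarith
  have hint : Integrable (fun y : ℝ => (1 + ‖y‖) ^ (-q)) :=
    integrable_one_add_norm (by simpa using hq)
  set I : ℝ := ∫ y : ℝ, (1 + ‖y‖) ^ (-q) with hI
  have hI0 : 0 ≤ I := integral_nonneg fun y => by positivity
  refine ⟨3 * (I + 1) ^ (1 / q), by positivity, fun ε h A N hε hA hN h1 h2 => ?_⟩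
  -- Add `‖h‖ ≤ A N` and `N |t| ‖h‖ ≤ (π/2) A N ≤ 2 A N`, the latter by `π ≤ 4`. The majorant has an
  -- integrable `q`-th power because `q > 1`, and rescaling by `N` produces the factor `N⁻¹`.
  have hb : ∀ t : ℝ, |t| ≤ π → ‖h t‖ ≤ 3 * A * N * (1 + ‖N * t‖)⁻¹ := fun t ht => by
    have hpos : 0 < 1 + ‖N * t‖ := by positivity
    rw [← div_eq_mul_inv, le_div_iff₀ hpos, Real.norm_eq_abs, abs_mul, abs_of_pos hN]
    have e1 := h1 t
    have e2 := mul_le_mul_of_nonneg_right (abs_le_norm_one_sub_fourier hε ht) (norm_nonneg (h t))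
    have e3 : |t| * ‖h t‖ ≤ π / 2 * A := by
      have e4 := e2.trans (h2 t)
      have e5 : |t| * ‖h t‖ = π / 2 * (2 / π * |t| * ‖h t‖) := by
        field_simp
      rw [e5]
      gcongr
    have e6 : π / 2 * A ≤ 2 * A := by
      have := Real.pi_le_four
      nlinarith
    have e7 : N * (|t| * ‖h t‖) ≤ N * (2 * A) := mul_le_mul_of_nonneg_left (by linarith) hN.le
    nlinarith
  have hqne : ENNReal.ofReal q ≠ 0 := by simpa using hq0
  rw [eLpNorm_eq_lintegral_rpow_enorm_toReal hqne ENNReal.ofReal_ne_top,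
    ENNReal.toReal_ofReal hq0.le]
  have hC : ENNReal.ofReal (3 * (I + 1) ^ (1 / q) * (A * N ^ (1 - 1 / q)))
      = (ENNReal.ofReal ((3 * A * N) ^ q * (N⁻¹ * (I + 1)))) ^ (1 / q) := by
    rw [ENNReal.ofReal_rpow_of_nonneg (by positivity) (by positivity),
      Real.mul_rpow (by positivity) (by positivity), ← Real.rpow_mul (by positivity),
      mul_one_div_cancel hq0.ne', Real.rpow_one, Real.mul_rpow (by positivity) (by positivity),
      Real.inv_rpow hN.le, Real.rpow_sub hN, Real.rpow_one]
    congr 1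
    field_simp
  rw [hC]
  refine ENNReal.rpow_le_rpow ?_ (by positivity)
  rw [← AddCircle.lintegral_preimage (2 * π) (-π)]
  calc ∫⁻ a : ℝ in Set.Ioc (-π) (-π + 2 * π), ‖h a‖ₑ ^ q
      ≤ ∫⁻ a : ℝ in Set.Ioc (-π) (-π + 2 * π),
          ENNReal.ofReal ((3 * A * N) ^ q * (1 + ‖N * a‖) ^ (-q)) := by
        refine setLIntegral_mono' measurableSet_Ioc fun t ht => ?_
        have ht' : |t| ≤ π := abs_le.2 ⟨ht.1.le, by linarith [ht.2]⟩
        rw [← ofReal_norm, ENNReal.ofReal_rpow_of_nonneg (norm_nonneg _) hq0.le]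
        refine ENNReal.ofReal_le_ofReal ?_
        calc ‖h t‖ ^ q ≤ (3 * A * N * (1 + ‖N * t‖)⁻¹) ^ q :=
              Real.rpow_le_rpow (norm_nonneg _) (hb t ht') hq0.le
          _ = _ := by
              rw [Real.mul_rpow (by positivity) (by positivity), Real.inv_rpow (by positivity),
                Real.rpow_neg (by positivity)]
    _ ≤ ∫⁻ a : ℝ, ENNReal.ofReal ((3 * A * N) ^ q * (1 + ‖N * a‖) ^ (-q)) :=
        setLIntegral_le_lintegral _ _
    _ = ENNReal.ofReal (∫ a : ℝ, (3 * A * N) ^ q * (1 + ‖N * a‖) ^ (-q)) := by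
        rw [ofReal_integral_eq_lintegral_ofReal]
        · exact (hint.comp_mul_left' hN.ne').const_mul _
        · exact ae_of_all _ fun x => by positivity
    _ ≤ _ := by
        refine ENNReal.ofReal_le_ofReal ?_
        rw [integral_const_mul,
          Measure.integral_comp_mul_left (fun y : ℝ => (1 + ‖y‖) ^ (-q)) N, abs_of_pos (by positivity),
          smul_eq_mul]
        gcongr
        linarith

/-! ### Summation by parts -/

/-- With the boundary term kept on the left, passing from `L` to `L + 1` adds exactly `(a (L+1) - a
L) z^(L+1)`. -/
theorem norm_one_sub_mul_sum_add_le (a : ℕ → ℝ) {z : ℂ} (hz : ‖z‖ = 1) (L : ℕ) :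
    ‖(1 - z) * ∑ k ∈ Finset.range L, (a k : ℂ) * z ^ k + a L * z ^ L‖
      ≤ |a 0| + ∑ k ∈ Finset.range L, |a (k + 1) - a k| := by
  induction L with
  | zero => simp
  | succ L ih =>
    have e : (1 - z) * ∑ k ∈ Finset.range (L + 1), (a k : ℂ) * z ^ k + a (L + 1) * z ^ (L + 1)
        = ((1 - z) * ∑ k ∈ Finset.range L, (a k : ℂ) * z ^ k + a L * z ^ L)
          + ((a (L + 1) - a L : ℝ) : ℂ) * z ^ (L + 1) := by
      rw [Finset.sum_range_succ]; push_cast; ring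
    rw [e, Finset.sum_range_succ, ← add_assoc]
    refine (norm_add_le _ _).trans (add_le_add ih ?_)
    rw [norm_mul, norm_pow, hz, one_pow, mul_one, Complex.norm_real, Real.norm_eq_abs]

/-- The variation telescopes to `a 0 - a L`, and the boundary term returns the `a L`. -/
theorem norm_one_sub_mul_sum_le_of_antitone {a : ℕ → ℝ} (ha : Antitone a) (h0 : ∀ k, 0 ≤ a k)
    {z : ℂ} (hz : ‖z‖ = 1) (L : ℕ) :
    ‖1 - z‖ * ‖∑ k ∈ Finset.range L, (a k : ℂ) * z ^ k‖ ≤ 2 * a 0 := by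
  have h1 := norm_one_sub_mul_sum_add_le a hz L
  have h2 : ∑ k ∈ Finset.range L, |a (k + 1) - a k| = a 0 - a L := by
    rw [← Finset.sum_range_sub']
    refine Finset.sum_congr rfl fun k _ => ?_
    rw [abs_sub_comm, abs_of_nonneg (sub_nonneg.2 (ha k.le_succ))]
  rw [h2, abs_of_nonneg (h0 0)] at h1
  have h3 : ‖(a L : ℂ) * z ^ L‖ = a L := by
    rw [norm_mul, norm_pow, hz, one_pow, mul_one, Complex.norm_real, Real.norm_of_nonneg (h0 L)]
  rw [← norm_mul]
  have h4 := norm_sub_norm_le ((1 - z) * ∑ k ∈ Finset.range L, (a k : ℂ) * z ^ k)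
    (-((a L : ℂ) * z ^ L))
  rw [sub_neg_eq_add, norm_neg, h3] at h4
  linarith

theorem norm_one_sub_mul_sum_le_of_monotone {a : ℕ → ℝ} (ha : Monotone a) (h0 : ∀ k, 0 ≤ a k)
    {z : ℂ} (hz : ‖z‖ = 1) (L : ℕ) :
    ‖1 - z‖ * ‖∑ k ∈ Finset.range (L + 1), (a k : ℂ) * z ^ k‖ ≤ 2 * a L := by
  have h1 := norm_one_sub_mul_sum_add_le a hz L
  have h2 : ∑ k ∈ Finset.range L, |a (k + 1) - a k| = a L - a 0 := by
    rw [← Finset.sum_range_sub]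
    refine Finset.sum_congr rfl fun k _ => ?_
    rw [abs_of_nonneg (sub_nonneg.2 (ha k.le_succ))]
  rw [h2, abs_of_nonneg (h0 0)] at h1
  have h3 : ‖(a L : ℂ) * z ^ (L + 1)‖ = a L := by
    rw [norm_mul, norm_pow, hz, one_pow, mul_one, Complex.norm_real, Real.norm_of_nonneg (h0 L)]
  have e : (1 - z) * ∑ k ∈ Finset.range (L + 1), (a k : ℂ) * z ^ k
      = ((1 - z) * ∑ k ∈ Finset.range L, (a k : ℂ) * z ^ k + a L * z ^ L)
        - (a L : ℂ) * z ^ (L + 1) := by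
    rw [Finset.sum_range_succ]; ring
  rw [← norm_mul, e]
  refine (norm_sub_le _ _).trans ?_
  rw [h3]
  linarith

/-! ### Sums of `exp (∓α k^r)` -/

/-- Bernoulli's inequality at `(y - x) / x`: a concave power lies below its tangents. -/
theorem rpow_le_tangent {r : ℝ} (hr0 : 0 ≤ r) (hr1 : r ≤ 1) {x y : ℝ} (hx : 0 < x) (hy : 0 ≤ y) :
    y ^ r ≤ x ^ r + r * x ^ (r - 1) * (y - x) := by
  have h := rpow_one_add_le_one_add_mul_self (s := (y - x) / x) (by
    rw [le_div_iff₀ hx]; linarith) hr0 hr1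
  have e : 1 + (y - x) / x = y / x := by field_simp; ring
  rw [e, Real.div_rpow hy hx.le, div_le_iff₀ (by positivity)] at h
  refine h.trans (le_of_eq ?_)
  rw [Real.rpow_sub_one hx.ne']
  field_simp

theorem sum_exp_neg_mul_le {x : ℝ} (hx : 0 < x) (L : ℕ) :
    ∑ u ∈ Finset.range L, Real.exp (-(x * u)) ≤ 1 + 1 / x := by
  have e : ∀ u : ℕ, Real.exp (-(x * u)) = Real.exp (-x) ^ u := fun u => by
    rw [← Real.exp_nat_mul]; ring_nf
  simp only [e]
  have h1 := geom_sum_mul_neg (Real.exp (-x)) L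
  have h2 : x / (1 + x) ≤ 1 - Real.exp (-x) := by
    have : Real.exp (-x) ≤ 1 / (1 + x) := by
      rw [Real.exp_neg, ← one_div]
      exact one_div_le_one_div_of_le (by linarith) (by linarith [Real.add_one_le_exp x])
    have e2 : x / (1 + x) = 1 - 1 / (1 + x) := by field_simp; ring
    linarith
  have h3 : (0 : ℝ) ≤ ∑ i ∈ Finset.range L, Real.exp (-x) ^ i :=
    Finset.sum_nonneg fun i _ => by positivity
  have h4 : (∑ i ∈ Finset.range L, Real.exp (-x) ^ i) * (x / (1 + x)) ≤ 1 := by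
    refine (mul_le_mul_of_nonneg_left h2 h3).trans ?_
    rw [h1]
    have : 0 ≤ Real.exp (-x) ^ L := by positivity
    linarith
  have e3 : 1 + 1 / x = 1 / (x / (1 + x)) := by field_simp; ring
  rw [e3, le_div_iff₀ (by positivity)]
  exact h4

theorem summable_exp_neg_mul_rpow {c r : ℝ} (hc : 0 < c) (hr : 0 < r) :
    Summable fun u : ℕ => Real.exp (-(c * (u : ℝ) ^ r)) := by
  -- With `t = u^r`, the decay `exp(-c t) = o(t^(-2/r))` becomes `o(u^(-2))`.
  have h := (isLittleO_exp_neg_mul_rpow_atTop hc (-2 / r)).comp_tendsto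
    ((tendsto_rpow_atTop hr).comp tendsto_natCast_atTop_atTop)
  refine summable_of_isBigO_nat (Real.summable_nat_rpow.2 (by norm_num : (-2 : ℝ) < -1)) ?_
  refine (h.isBigO.congr_left fun u => ?_).congr_right fun u => ?_
  · simp
  · simp only [Function.comp]
    rw [← Real.rpow_mul (by positivity), mul_div_cancel₀ _ hr.ne']

/-- The tangent at `n + u` gives `(n+u)^r - n^r ≥ r u (n+u)^(r-1)`. For `u ≤ n` this is at least
`(r/2) n^(r-1) u`, a geometric decay with sum of order `n^(1-r)`; for `u ≥ n` it is at least `(r/2)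
u^r`, which contributes a bounded amount. -/
theorem exists_sum_exp_neg_rpow_le {α r : ℝ} (hα : 0 < α) (hr0 : 0 < r) (hr1 : r < 1) :
    ∃ C : ℝ, 0 < C ∧ ∀ n : ℕ, 1 ≤ n → ∀ L : ℕ,
      ∑ u ∈ Finset.range L, Real.exp (-α * ((n + u : ℕ) : ℝ) ^ r)
        ≤ Real.exp (-α * (n : ℝ) ^ r) * (C * (n : ℝ) ^ (1 - r)) := by
  set c : ℝ := α * r / 2 with hc
  have hc0 : 0 < c := by positivity
  have hs := summable_exp_neg_mul_rpow hc0 hr0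
  set S := ∑' u : ℕ, Real.exp (-(c * (u : ℝ) ^ r)) with hS
  have hS0 : 0 ≤ S := tsum_nonneg fun u => by positivity
  refine ⟨1 + 1 / c + S, by positivity, fun n hn L => ?_⟩
  have hn1 : (1 : ℝ) ≤ n := by exact_mod_cast hn
  have hn0 : (0 : ℝ) < n := by linarith
  have hn2 : 1 ≤ (n : ℝ) ^ (1 - r) := Real.one_le_rpow hn1 (by linarith)
  have half : (1 / 2 : ℝ) ≤ 2 ^ (r - 1) := by
    have : (2 : ℝ) ^ (-1 : ℝ) ≤ 2 ^ (r - 1) :=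
      Real.rpow_le_rpow_of_exponent_le (by norm_num) (by linarith)
    rw [Real.rpow_neg_one] at this
    linarith
  have hterm : ∀ u : ℕ, Real.exp (-α * ((n + u : ℕ) : ℝ) ^ r) ≤ Real.exp (-α * (n : ℝ) ^ r) *
      (Real.exp (-(c * (n : ℝ) ^ (r - 1) * u)) + Real.exp (-(c * (u : ℝ) ^ r))) := fun u => by
    have hu0 : (0 : ℝ) ≤ u := by positivity
    have ht := rpow_le_tangent hr0.le hr1.le (x := ((n : ℝ) + u)) (y := n) (by positivity) hn0.le
    have e : (n : ℝ) - (n + u) = -u := by ring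
    rw [e] at ht
    rw [mul_add, ← Real.exp_add, ← Real.exp_add]
    push_cast
    rcases le_total (u : ℝ) n with hle | hle
    · have h1 : (1 / 2) * (n : ℝ) ^ (r - 1) ≤ ((n : ℝ) + u) ^ (r - 1) := by
        calc (1 / 2) * (n : ℝ) ^ (r - 1) ≤ 2 ^ (r - 1) * (n : ℝ) ^ (r - 1) := by gcongr
          _ = (2 * (n : ℝ)) ^ (r - 1) := by rw [Real.mul_rpow (by norm_num) hn0.le]
          _ ≤ _ := Real.rpow_le_rpow_of_nonpos (by positivity) (by linarith) (by linarith)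
      have h2 := mul_le_mul_of_nonneg_right h1 (mul_nonneg (mul_nonneg hα.le hr0.le) hu0)
      refine le_add_of_le_of_nonneg (Real.exp_le_exp.2 ?_) (Real.exp_pos _).le
      rw [hc]
      nlinarith
    · have hup : (0 : ℝ) < u := by linarith
      have h1 : (1 / 2) * (u : ℝ) ^ (r - 1) ≤ ((n : ℝ) + u) ^ (r - 1) := by
        calc (1 / 2) * (u : ℝ) ^ (r - 1) ≤ 2 ^ (r - 1) * (u : ℝ) ^ (r - 1) := by gcongr
          _ = (2 * (u : ℝ)) ^ (r - 1) := by rw [Real.mul_rpow (by norm_num) hu0]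
          _ ≤ _ := Real.rpow_le_rpow_of_nonpos (by positivity) (by linarith) (by linarith)
      have h2 := mul_le_mul_of_nonneg_right h1 (mul_nonneg (mul_nonneg hα.le hr0.le) hu0)
      have h3 : (u : ℝ) ^ r = (u : ℝ) ^ (r - 1) * u := by
        rw [Real.rpow_sub_one hup.ne']; field_simp
      refine le_add_of_nonneg_of_le (Real.exp_pos _).le (Real.exp_le_exp.2 ?_)
      rw [hc, h3]
      nlinarith
  refine (Finset.sum_le_sum fun u _ => hterm u).trans ?_
  rw [← Finset.mul_sum, Finset.sum_add_distrib]
  refine mul_le_mul_of_nonneg_left ?_ (Real.exp_pos _).le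
  have h1 := sum_exp_neg_mul_le (x := c * (n : ℝ) ^ (r - 1)) (by positivity) L
  have h2 : ∑ u ∈ Finset.range L, Real.exp (-(c * (u : ℝ) ^ r)) ≤ S :=
    hs.sum_le_tsum _ fun u _ => by positivity
  have h3 : 1 / (c * (n : ℝ) ^ (r - 1)) = 1 / c * (n : ℝ) ^ (1 - r) := by
    rw [← neg_sub r 1, Real.rpow_neg hn0.le]; field_simp
  rw [h3] at h1
  nlinarith

/-- Read backwards from `N`, the tangent at `N` alone yields geometric decay at rate `α r N^(r-1)`;
no splitting is needed. -/
theorem exists_sum_exp_rpow_le {α r : ℝ} (hα : 0 < α) (hr0 : 0 < r) (hr1 : r < 1) :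
    ∃ C : ℝ, 0 < C ∧ ∀ N : ℕ, 1 ≤ N →
      ∑ k ∈ Finset.range N, Real.exp (α * ((k + 1 : ℕ) : ℝ) ^ r)
        ≤ Real.exp (α * (N : ℝ) ^ r) * (C * (N : ℝ) ^ (1 - r)) := by
  have hc0 : 0 < α * r := by positivity
  refine ⟨1 + 1 / (α * r), by positivity, fun N hN => ?_⟩
  have hn1 : (1 : ℝ) ≤ N := by exact_mod_cast hN
  have hn0 : (0 : ℝ) < N := by linarith
  have hn2 : 1 ≤ (N : ℝ) ^ (1 - r) := Real.one_le_rpow hn1 (by linarith)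
  rw [← Finset.sum_range_reflect]
  have hterm : ∀ j ∈ Finset.range N, Real.exp (α * ((N - 1 - j + 1 : ℕ) : ℝ) ^ r) ≤
      Real.exp (α * (N : ℝ) ^ r) * Real.exp (-(α * r * (N : ℝ) ^ (r - 1) * j)) := fun j hj => by
    have hj' : j < N := Finset.mem_range.1 hj
    have ht := rpow_le_tangent hr0.le hr1.le (x := (N : ℝ)) (y := ((N - 1 - j + 1 : ℕ) : ℝ))
      hn0 (by positivity)
    have e : ((N - 1 - j + 1 : ℕ) : ℝ) - N = -j := by
      have : N - 1 - j + 1 = N - j := by omega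
      rw [this, Nat.cast_sub hj'.le]; ring
    rw [e] at ht
    rw [← Real.exp_add, Real.exp_le_exp]
    nlinarith
  refine (Finset.sum_le_sum hterm).trans ?_
  rw [← Finset.mul_sum]
  refine mul_le_mul_of_nonneg_left ?_ (Real.exp_pos _).le
  have h1 := sum_exp_neg_mul_le (x := α * r * (N : ℝ) ^ (r - 1)) (by positivity) N
  have h3 : 1 / (α * r * (N : ℝ) ^ (r - 1)) = 1 / (α * r) * (N : ℝ) ^ (1 - r) := by
    rw [← neg_sub r 1, Real.rpow_neg hn0.le]; field_simp
  rw [h3] at h1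
  nlinarith

/-! ### Fourier multipliers on summable functions -/

theorem eLpNorm_eq_ofReal_norm_toLp (p : ℝ≥0∞) [Fact (1 ≤ p)] (g : C(Circle2Pi, ℂ)) :
    eLpNorm g p volume = ENNReal.ofReal ‖ContinuousMap.toLp (E := ℂ) p volume ℂ g‖ := by
  rw [Lp.norm_def, ENNReal.ofReal_toReal (Lp.eLpNorm_ne_top _)]
  exact eLpNorm_congr_ae (ContinuousMap.coeFn_toLp (𝕜 := ℂ) volume g).symm

theorem fourier_sub_apply (k : ℤ) (x t : Circle2Pi) :
    (fourier k (x - t) : ℂ) = fourier (-k) t * fourier k x := by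
  rw [fourier_apply, fourier_apply, fourier_apply, smul_sub, sub_eq_add_neg,
    AddCircle.toCircle_add, neg_smul, Circle.coe_mul, mul_comm]

/-- Convolution with a trigonometric polynomial `K` maps `L_1` to `L_p` with norm at most
`‖K‖_p`. -/
theorem eLpNorm_sum_fourierCoeff_le {ι : Type*} (S : Finset ι) (m : ι → ℤ) (a : ι → ℂ)
    {φ : Circle2Pi → ℂ} (hφ : Integrable φ AddCircle.haarAddCircle) (p : ℝ≥0∞) (hp : 1 ≤ p) :
    eLpNorm (fun x : Circle2Pi => ∑ i ∈ S, a i * fourierCoeff φ (m i) * (fourier (m i) x : ℂ)) p volume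
      ≤ eLpNorm (fun x : Circle2Pi => ∑ i ∈ S, a i * (fourier (m i) x : ℂ)) p volume *
        ENNReal.ofReal (∫ x, ‖φ x‖ ∂AddCircle.haarAddCircle) := by
  have : Fact (1 ≤ p) := ⟨hp⟩
  let P : (ι → ℂ) → C(Circle2Pi, ℂ) := fun b => ∑ i ∈ S, b i • fourier (m i)
  have hP : ∀ b x, P b x = ∑ i ∈ S, b i * (fourier (m i) x : ℂ) := fun b x => by
    simp [P, ContinuousMap.sum_apply]
  let Q : (ι → ℂ) → Lp ℂ p (volume : Measure Circle2Pi) := fun b =>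
    ContinuousMap.toLp (E := ℂ) p volume ℂ (P b)
  have hN : ∀ b, eLpNorm (fun x : Circle2Pi => ∑ i ∈ S, b i * (fourier (m i) x : ℂ)) p volume
      = ENNReal.ofReal ‖Q b‖ := fun b => by
    rw [← eLpNorm_eq_ofReal_norm_toLp]
    congr 1
    ext x
    rw [hP]
  have hQ : ∀ b, Q b = ∑ i ∈ S, b i • ContinuousMap.toLp (E := ℂ) p volume ℂ (fourier (m i)) :=
    fun b => by simp [Q, P, map_sum]
  -- These coefficients belong to the translate by `t`, which has the same norm. The convolution is
  -- then an `L_p`-valued integral of translates, and Minkowski's inequality is the norm bound for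
  -- that integral.
  have htrans : ∀ t : Circle2Pi, ‖Q fun i => a i * fourier (-m i) t‖ = ‖Q a‖ := fun t => by
    rw [← ENNReal.ofReal_eq_ofReal_iff (norm_nonneg _) (norm_nonneg _), ← hN, ← hN]
    have hmp := measurePreserving_sub_right (volume : Measure Circle2Pi) t
    have hc : AEStronglyMeasurable (fun x : Circle2Pi => ∑ i ∈ S, a i * (fourier (m i) x : ℂ))
        (volume : Measure Circle2Pi) := by
      have : (fun x : Circle2Pi => ∑ i ∈ S, a i * (fourier (m i) x : ℂ)) = P a := by ext x; rw [hP]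
      rw [this]
      exact (P a).continuous.aestronglyMeasurable
    rw [← eLpNorm_comp_measurePreserving hc hmp]
    congr 1
    ext x
    simp only [Function.comp, fourier_sub_apply, mul_assoc]
  have hint : ∀ i, Integrable (fun t => (a i * fourier (-m i) t) * φ t)
      AddCircle.haarAddCircle := fun i => by
    have := (hφ.fourier_smul (-m i)).const_mul (a i)
    simpa [mul_assoc] using this
  have hV : ∫ t, φ t • Q (fun i => a i * fourier (-m i) t) ∂AddCircle.haarAddCircle
      = Q fun i => a i * fourierCoeff φ (m i) := by
    have e : ∀ t, φ t • Q (fun i => a i * fourier (-m i) t) = ∑ i ∈ S,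
        ((a i * fourier (-m i) t) * φ t) •
          ContinuousMap.toLp (E := ℂ) p volume ℂ (fourier (m i)) := fun t => by
      rw [hQ, Finset.smul_sum]
      refine Finset.sum_congr rfl fun i _ => ?_
      rw [smul_smul, mul_comm (φ t)]
    simp only [e]
    rw [integral_finsetSum _ fun i _ => (hint i).smul_const _, hQ]
    refine Finset.sum_congr rfl fun i _ => ?_
    rw [integral_smul_const]
    congr 1
    simp only [mul_assoc, integral_const_mul, fourierCoeff, smul_eq_mul]
  have e1 : (fun x : Circle2Pi => ∑ i ∈ S, a i * fourierCoeff φ (m i) * (fourier (m i) x : ℂ))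
      = fun x => ∑ i ∈ S, (fun i => a i * fourierCoeff φ (m i)) i * (fourier (m i) x : ℂ) := rfl
  rw [e1, hN, hN, ← ENNReal.ofReal_mul (norm_nonneg _), ← hV]
  refine ENNReal.ofReal_le_ofReal ((norm_integral_le_integral_norm _).trans (le_of_eq ?_))
  rw [← integral_const_mul]
  congr 1
  ext t
  rw [norm_smul, htrans, mul_comm]

theorem fourier_mul_natCast (ε : ℤ) (k : ℕ) (x : Circle2Pi) :
    (fourier (ε * k) x : ℂ) = (fourier ε x : ℂ) ^ k := by
  induction k with
  | zero => simp
  | succ k ih => rw [Nat.cast_succ, mul_add, mul_one, fourier_add, ih, pow_succ]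

theorem norm_fourier_apply (k : ℤ) (x : Circle2Pi) : ‖(fourier k x : ℂ)‖ = 1 :=
  Circle.norm_coe _

/-- After the unimodular factor `e^{iεnx}` is removed, the kernel bound applies with `A = 2ψ(n)`
from Abel summation and `N` of order `n^(1-r)`. Uniformity in `L` is what permits a limit
afterwards. -/
theorem exists_eLpNorm_exp_kernel_le {α r s : ℝ} (hα : 0 < α) (hr0 : 0 < r) (hr1 : r < 1)
    (hs : 1 < s) :
    ∃ C : ℝ, 0 < C ∧ ∀ (ε : ℤ), (ε = 1 ∨ ε = -1) → ∀ n : ℕ, 1 ≤ n → ∀ L : ℕ,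
      eLpNorm (fun x : Circle2Pi => ∑ k ∈ Finset.range L,
        (Real.exp (-α * ((n + k : ℕ) : ℝ) ^ r) : ℂ) * (fourier (ε * (n + k : ℕ)) x : ℂ))
        (ENNReal.ofReal s) volume
      ≤ ENNReal.ofReal (C * (Real.exp (-α * (n : ℝ) ^ r) * (n : ℝ) ^ ((1 - r) * (1 - 1 / s)))) := by
  obtain ⟨C₁, hC₁, h₁⟩ := exists_eLpNorm_le_of_kernel_bound hs
  obtain ⟨C₂, hC₂, h₂⟩ := exists_sum_exp_neg_rpow_le hα hr0 hr1
  refine ⟨C₁ * 2 * C₂ ^ (1 - 1 / s), by positivity, fun ε hε n hn L => ?_⟩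
  have hn0 : (0 : ℝ) < n := by exact_mod_cast hn
  set a : ℕ → ℝ := fun k => Real.exp (-α * ((n + k : ℕ) : ℝ) ^ r) with ha
  have ha0 : a 0 = Real.exp (-α * (n : ℝ) ^ r) := by simp [ha]
  have hanti : Antitone a := fun i j hij => by
    simp only [ha, Real.exp_le_exp, neg_mul, neg_le_neg_iff]
    gcongr
  have hapos : ∀ k, 0 ≤ a k := fun k => (Real.exp_pos _).le
  have hfac : ∀ x : Circle2Pi, ‖∑ k ∈ Finset.range L, (a k : ℂ) * (fourier (ε * (n + k : ℕ)) x : ℂ)‖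
      = ‖∑ k ∈ Finset.range L, (a k : ℂ) * (fourier ε x : ℂ) ^ k‖ := fun x => by
    have : ∑ k ∈ Finset.range L, (a k : ℂ) * (fourier (ε * (n + k : ℕ)) x : ℂ)
        = (fourier ε x : ℂ) ^ n * ∑ k ∈ Finset.range L, (a k : ℂ) * (fourier ε x : ℂ) ^ k := by
      rw [Finset.mul_sum]
      refine Finset.sum_congr rfl fun k _ => ?_
      rw [fourier_mul_natCast, pow_add]
      ring
    rw [this, norm_mul, norm_pow, norm_fourier_apply, one_pow, one_mul]
  refine (h₁ ε _ (2 * a 0) (C₂ * (n : ℝ) ^ (1 - r)) hε (by positivity) (by positivity)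
    (fun x => ?_) (fun x => ?_)).trans (ENNReal.ofReal_le_ofReal (le_of_eq ?_))
  · refine (norm_sum_le _ _).trans ?_
    have e : ∀ k, ‖(a k : ℂ) * (fourier (ε * (n + k : ℕ)) x : ℂ)‖ = a k := fun k => by
      rw [norm_mul, norm_fourier_apply, mul_one, Complex.norm_real, Real.norm_of_nonneg (hapos k)]
    refine (Finset.sum_le_sum fun k _ => (e k).le).trans ?_
    refine (h₂ n hn L).trans ?_
    rw [ha0]
    gcongr
    linarith [Real.exp_pos (-α * (n : ℝ) ^ r)]
  · rw [hfac]
    exact norm_one_sub_mul_sum_le_of_antitone hanti hapos (norm_fourier_apply ε x) L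
  · rw [ha0, Real.mul_rpow hC₂.le (by positivity), ← Real.rpow_mul hn0.le]
    ring

/-! ### The upper estimate -/

/-- Normalising the measure divides by `2π ≥ 1`, so the bound only improves. -/
theorem integral_norm_haarAddCircle_le_one {φ : Circle2Pi → ℝ} (hφ : MemLp φ 1 volume)
    (h1 : eLpNorm φ 1 volume ≤ 1) :
    ∫ x, ‖(φ x : ℂ)‖ ∂AddCircle.haarAddCircle ≤ 1 := by
  rw [AddCircle.integral_haarAddCircle, smul_eq_mul]
  have h2 : ∫ x, ‖(φ x : ℂ)‖ ≤ 1 := by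
    simp only [Complex.norm_real]
    rw [integral_norm_eq_lintegral_enorm hφ.1, ← eLpNorm_one_eq_lintegral_enorm]
    simpa using ENNReal.toReal_mono ENNReal.one_ne_top h1
  have h3 : (2 * π)⁻¹ ≤ 1 := inv_le_one_of_one_le₀ (by linarith [Real.pi_gt_three])
  have h4 : 0 ≤ ∫ x : Circle2Pi, ‖(φ x : ℂ)‖ := integral_nonneg fun x => norm_nonneg _
  calc (2 * π)⁻¹ * ∫ x, ‖(φ x : ℂ)‖ ≤ 1 * 1 := by gcongr
    _ = 1 := one_mul 1

theorem norm_coeff_le_one {φ : Circle2Pi → ℝ} (hφ : MemLp φ 1 volume)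
    (h1 : eLpNorm φ 1 volume ≤ 1) (k : ℤ) : ‖coeff φ k‖ ≤ 1 := by
  refine (norm_integral_le_integral_norm _).trans (le_trans (le_of_eq ?_)
    (integral_norm_haarAddCircle_le_one hφ h1))
  congr 1
  ext x
  rw [norm_smul, norm_fourier_apply, one_mul]

theorem integrable_ofReal_haarAddCircle {φ : Circle2Pi → ℝ} (hφ : MemLp φ 1 volume) :
    Integrable (fun x => (φ x : ℂ)) (AddCircle.haarAddCircle : Measure Circle2Pi) :=
  memLp_one_iff_integrable.1 hφ.ofReal.haarAddCircle

theorem sum_Icc_neg_add (g : ℤ → ℂ) (m L : ℕ) :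
    ∑ k ∈ Finset.Icc (-((m + L : ℕ) : ℤ)) ((m + L : ℕ) : ℤ), g k
      = ∑ k ∈ Finset.Icc (-(m : ℤ)) m, g k
        + (∑ k ∈ Finset.range L, g (1 * (m + 1 + k : ℕ))
          + ∑ k ∈ Finset.range L, g (-1 * (m + 1 + k : ℕ))) := by
  induction L with
  | zero => simp
  | succ L ih =>
    rw [Finset.sum_range_succ, Finset.sum_range_succ]
    have := Finset.sum_Icc_succ_eq_add_endpoints g (N := m + L)
    rw [← add_assoc m L 1, Nat.cast_succ, this, ih]
    have e1 : (1 : ℤ) * (m + 1 + L : ℕ) = ((m + L : ℕ) : ℤ) + 1 := by push_cast; ring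
    have e2 : (-1 : ℤ) * (m + 1 + L : ℕ) = -(((m + L : ℕ) : ℤ) + 1) := by push_cast; ring
    rw [e1, e2]
    ring

section

variable {α r β : ℝ} {f φ : Circle2Pi → ℝ}

/-- The phase depends only on the sign of `k`, so on each half-line it factors out of sums and
disappears from norms. -/
theorem IsPsiBetaDeriv.exists_coeff_eq
    (h : IsPsiBetaDeriv (fun k => Real.exp (-α * (k : ℝ) ^ r)) β f φ) {k : ℤ} (hk : k ≠ 0) :
    coeff f k = Complex.exp (Complex.I * ((-(β * π / 2 * (k.sign : ℝ)) : ℝ) : ℂ)) *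
      (Real.exp (-α * (k.natAbs : ℝ) ^ r) * coeff φ k) := by
  have := h.2 k
  rw [if_neg hk] at this
  rw [this, Complex.ofReal_neg, mul_neg, Complex.exp_neg]
  have h1 : ((Real.exp (-α * (k.natAbs : ℝ) ^ r) : ℝ) : ℂ) ≠ 0 := by
    exact_mod_cast (Real.exp_pos _).ne'
  have h2 := Complex.exp_ne_zero (Complex.I * ((β * π / 2 * (k.sign : ℝ) : ℝ) : ℂ))
  field_simp

theorem norm_exp_I_mul_ofReal (x : ℝ) : ‖Complex.exp (Complex.I * x)‖ = 1 := by
  rw [mul_comm]; exact Complex.norm_exp_ofReal_mul_I x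

theorem IsPsiBetaDeriv.norm_coeff_le
    (h : IsPsiBetaDeriv (fun k => Real.exp (-α * (k : ℝ) ^ r)) β f φ)
    (h1 : eLpNorm φ 1 volume ≤ 1) {k : ℤ} (hk : k ≠ 0) :
    ‖coeff f k‖ ≤ Real.exp (-α * (k.natAbs : ℝ) ^ r) := by
  rw [h.exists_coeff_eq hk, norm_mul, norm_exp_I_mul_ofReal, one_mul, norm_mul, Complex.norm_real,
    Real.norm_of_nonneg (Real.exp_pos _).le]
  exact mul_le_of_le_one_right (Real.exp_pos _).le (norm_coeff_le_one h.1 h1 k)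

theorem IsPsiBetaDeriv.summable_coeff (hα : 0 < α) (hr0 : 0 < r)
    (h : IsPsiBetaDeriv (fun k => Real.exp (-α * (k : ℝ) ^ r)) β f φ)
    (h1 : eLpNorm φ 1 volume ≤ 1) : Summable (coeff f) := by
  -- The class leaves `coeff f 0` free; the factor `1 + ‖coeff f 0‖` covers `k = 0`, where the
  -- exponential is `1`.
  have hb : ∀ k : ℤ, ‖coeff f k‖ ≤ (1 + ‖coeff f 0‖) * Real.exp (-(α * (k.natAbs : ℝ) ^ r)) :=
    fun k => by
    by_cases hk : k = 0
    · subst hk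
      simp [Real.zero_rpow hr0.ne']
    · refine (h.norm_coeff_le h1 hk).trans ?_
      rw [neg_mul]
      refine le_mul_of_one_le_left (Real.exp_pos _).le ?_
      linarith [norm_nonneg (coeff f 0)]
  have hs := (summable_exp_neg_mul_rpow hα hr0).mul_left (1 + ‖coeff f 0‖)
  rw [summable_int_iff_summable_nat_and_neg]
  constructor
  · refine Summable.of_norm_bounded hs fun k => ?_
    simpa using hb k
  · refine Summable.of_norm_bounded hs fun k => ?_
    simpa using hb (-k)

theorem continuous_sum_fourier {ι : Type*} (S : Finset ι) (m : ι → ℤ) (a : ι → ℂ) :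
    Continuous fun x : Circle2Pi => ∑ i ∈ S, a i * (fourier (m i) x : ℂ) :=
  continuous_finsetSum _ fun i _ => continuous_const.mul (fourier (m i)).continuous

end

/-- Symmetric partial sums of order `n - 1` approximate the class with the order
`exp (-α n ^ r) n ^ ((1 - r) (1 - 1 / s))`. -/
theorem exists_eLpNorm_sub_partialSum_le {α r s : ℝ} (β : ℝ) (hα : 0 < α) (hr0 : 0 < r)
    (hr1 : r < 1) (hs : 1 < s) :
    ∃ C : ℝ, 0 < C ∧ ∀ f ∈ expClass α r β 1, ∀ m : ℕ,
      eLpNorm (fun x => (f x : ℂ) - partialSum (Finset.Icc (-(m : ℤ)) m) f x)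
        (ENNReal.ofReal s) volume
      ≤ ENNReal.ofReal (C * (Real.exp (-α * ((m + 1 : ℕ) : ℝ) ^ r) *
          ((m + 1 : ℕ) : ℝ) ^ ((1 - r) * (1 - 1 / s)))) := by
  obtain ⟨C, hC, hk⟩ := exists_eLpNorm_exp_kernel_le hα hr0 hr1 hs
  refine ⟨C + C, by positivity, fun f hf m => ?_⟩
  obtain ⟨hf1, φ, hd, hφ, hφ1, -⟩ := hf
  have hs1 : 1 ≤ ENNReal.ofReal s := by
    rw [← ENNReal.ofReal_one]; exact ENNReal.ofReal_le_ofReal hs.le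
  set R := Real.exp (-α * ((m + 1 : ℕ) : ℝ) ^ r) *
    ((m + 1 : ℕ) : ℝ) ^ ((1 - r) * (1 - 1 / s)) with hR
  have hR0 : 0 ≤ R := by positivity
  have half : ∀ ε : ℤ, (ε = 1 ∨ ε = -1) → ∀ L : ℕ,
      eLpNorm (fun x : Circle2Pi => ∑ k ∈ Finset.range L,
        coeff f (ε * (m + 1 + k : ℕ)) * (fourier (ε * (m + 1 + k : ℕ)) x : ℂ))
        (ENNReal.ofReal s) volume ≤ ENNReal.ofReal (C * R) := fun ε hε L => by
    have h1 := eLpNorm_sum_fourierCoeff_le (Finset.range L) (fun k => ε * (m + 1 + k : ℕ))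
      (fun k => (Real.exp (-α * ((m + 1 + k : ℕ) : ℝ) ^ r) : ℂ))
      (integrable_ofReal_haarAddCircle hφ) (ENNReal.ofReal s) hs1
    have h2 := hk ε hε (m + 1) (by omega) L
    have h3 : ENNReal.ofReal (∫ x, ‖(φ x : ℂ)‖ ∂AddCircle.haarAddCircle) ≤ 1 := by
      rw [← ENNReal.ofReal_one]
      exact ENNReal.ofReal_le_ofReal (integral_norm_haarAddCircle_le_one hφ hφ1)
    refine le_trans (le_of_eq (eLpNorm_congr_norm_ae (ae_of_all _ fun x => ?_)))
      (h1.trans ((mul_le_mul' h2 h3).trans_eq (mul_one _)))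
    have e : ∀ k : ℕ, coeff f (ε * (m + 1 + k : ℕ)) =
        Complex.exp (Complex.I * ((-(β * π / 2 * (ε.sign : ℝ)) : ℝ) : ℂ)) *
        (Real.exp (-α * ((m + 1 + k : ℕ) : ℝ) ^ r) * coeff φ (ε * (m + 1 + k : ℕ))) := fun k => by
      have hpos : (0 : ℤ) < (m + 1 + k : ℕ) := by exact_mod_cast (by omega)
      have hne : ε * (m + 1 + k : ℕ) ≠ 0 := by
        rcases hε with rfl | rfl <;> omega
      rw [hd.exists_coeff_eq hne, Int.sign_mul, Int.sign_eq_one_of_pos hpos, mul_one,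
        Int.natAbs_mul, Int.natAbs_natCast]
      rcases hε with rfl | rfl <;> simp
    simp only [e, mul_assoc, ← Finset.mul_sum]
    rw [norm_mul, norm_exp_I_mul_ofReal, one_mul]
    rfl
  have hT : ∀ L : ℕ, eLpNorm (fun x : Circle2Pi =>
      (∑ k ∈ Finset.range L, coeff f (1 * (m + 1 + k : ℕ)) * (fourier (1 * (m + 1 + k : ℕ)) x : ℂ))
      + ∑ k ∈ Finset.range L,
        coeff f (-1 * (m + 1 + k : ℕ)) * (fourier (-1 * (m + 1 + k : ℕ)) x : ℂ))
      (ENNReal.ofReal s) volume ≤ ENNReal.ofReal ((C + C) * R) := fun L => by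
    refine (eLpNorm_add_le (continuous_sum_fourier _ _ _).aestronglyMeasurable
      (continuous_sum_fourier _ _ _).aestronglyMeasurable hs1).trans ?_
    rw [add_mul, ENNReal.ofReal_add (by positivity) (by positivity)]
    exact add_le_add (half 1 (Or.inl rfl) L) (half (-1) (Or.inr rfl) L)
  -- Fatou's lemma: the remainder is the almost everywhere limit of the finite two-sided tails,
  -- whose norms are bounded uniformly in `L`.
  refine (Lp.eLpNorm_lim_le_liminf_eLpNorm (fun L =>
    ((continuous_sum_fourier _ _ _).add (continuous_sum_fourier _ _ _)).aestronglyMeasurable) _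
    ?_).trans ((liminf_le_liminf (Eventually.of_forall hT)).trans (liminf_const _).le)
  have hae : ∀ᵐ x : Circle2Pi, HasSum (fun n => coeff f n * fourier n x) ((f x : ℝ) : ℂ) := by
    rw [AddCircle.volume_eq_smul_haarAddCircle]
    exact Measure.ae_smul_measure (ae_hasSum_fourier_of_summable
      (integrable_ofReal_haarAddCircle hf1) (hd.summable_coeff hα hr0 hφ1)) _
  filter_upwards [hae] with x hx
  have h1 := (hx.comp (Finset.tendsto_Icc_neg (R := ℤ))).comp
    (tendsto_add_atTop_nat m)
  have h2 := h1.sub_const (partialSum (Finset.Icc (-(m : ℤ)) m) f x)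
  refine h2.congr fun L => ?_
  simp only [Function.comp]
  rw [Pi.add_apply, add_comm L m]
  have := sum_Icc_neg_add (fun n => coeff f n * (fourier n x : ℂ)) m L
  rw [sub_eq_iff_eq_add, add_comm _ (partialSum _ _ _)]
  exact this

/-- The frequencies `|k| ≤ n - 1` number exactly `2n - 1`. For `2n`, adjoining the frequency `n`
costs one term of norm at most `(2π)^(1/s) ψ(n)`, which the rate absorbs because its power of `n` is
at least `1`. -/
theorem exists_bestOrth_le {α r s : ℝ} (β : ℝ) (hα : 0 < α) (hr0 : 0 < r)
    (hr1 : r < 1) (hs : 1 < s) :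
    ∃ C : ℝ, 0 < C ∧ ∀ n : ℕ, 1 ≤ n →
      bestOrthClass (2 * n - 1) (expClass α r β 1) (ENNReal.ofReal s)
        ≤ ENNReal.ofReal (C * (Real.exp (-α * (n : ℝ) ^ r) * (n : ℝ) ^ ((1 - r) * (1 - 1 / s)))) ∧
      bestOrthClass (2 * n) (expClass α r β 1) (ENNReal.ofReal s)
        ≤ ENNReal.ofReal (C * (Real.exp (-α * (n : ℝ) ^ r) * (n : ℝ) ^ ((1 - r) * (1 - 1 / s)))) := by
  obtain ⟨C, hC, hk⟩ := exists_eLpNorm_sub_partialSum_le β hα hr0 hr1 hs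
  set D : ℝ := (2 * π) ^ (1 / s) with hD
  have hs1 : 1 ≤ ENNReal.ofReal s := by
    rw [← ENNReal.ofReal_one]; exact ENNReal.ofReal_le_ofReal hs.le
  refine ⟨C + D, by positivity, fun n hn => ?_⟩
  obtain ⟨m, rfl⟩ : ∃ m, n = m + 1 := ⟨n - 1, by omega⟩
  set R := Real.exp (-α * ((m + 1 : ℕ) : ℝ) ^ r) *
    ((m + 1 : ℕ) : ℝ) ^ ((1 - r) * (1 - 1 / s)) with hR
  have hR0 : 0 ≤ R := by positivity
  have hcard : (Finset.Icc (-(m : ℤ)) m).card = 2 * (m + 1) - 1 := by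
    rw [Int.card_Icc]; omega
  have hnot : ((m + 1 : ℕ) : ℤ) ∉ Finset.Icc (-(m : ℤ)) m := by
    rw [Finset.mem_Icc]; push_cast; omega
  refine ⟨iSup₂_le fun f hf => ?_, iSup₂_le fun f hf => ?_⟩
  · refine (iInf₂_le (Finset.Icc (-(m : ℤ)) m) hcard).trans ((hk f hf m).trans (ENNReal.ofReal_le_ofReal ?_))
    have : 0 ≤ D := by positivity
    nlinarith
  · refine (iInf₂_le (insert ((m + 1 : ℕ) : ℤ) (Finset.Icc (-(m : ℤ)) m)) (by
      rw [Finset.card_insert_of_notMem hnot, hcard]; omega)).trans ?_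
    have e : (fun x => (f x : ℂ) - partialSum (insert ((m + 1 : ℕ) : ℤ)
        (Finset.Icc (-(m : ℤ)) m)) f x)
        = (fun x => (f x : ℂ) - partialSum (Finset.Icc (-(m : ℤ)) m) f x)
          - fun x => coeff f ((m + 1 : ℕ) : ℤ) * (fourier ((m + 1 : ℕ) : ℤ) x : ℂ) := by
      ext x
      simp only [partialSum, Finset.sum_insert hnot, Pi.sub_apply]
      ring
    have hm1 : AEStronglyMeasurable
        (fun x => (f x : ℂ) - partialSum (Finset.Icc (-(m : ℤ)) m) f x) volume :=
      hf.1.ofReal.1.sub (continuous_sum_fourier _ _ _).aestronglyMeasurable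
    have hm2 : Continuous (fun x : Circle2Pi =>
        coeff f ((m + 1 : ℕ) : ℤ) * (fourier ((m + 1 : ℕ) : ℤ) x : ℂ)) :=
      continuous_const.mul (fourier _).continuous
    rw [e]
    refine (eLpNorm_sub_le hm1 hm2.aestronglyMeasurable hs1).trans ?_
    rw [add_mul, ENNReal.ofReal_add (by positivity) (by positivity)]
    refine add_le_add (hk f hf m) ?_
    obtain ⟨hf1, φ, hd, hφ, hφ1, -⟩ := hf
    have hb : ∀ x : Circle2Pi, ‖coeff f ((m + 1 : ℕ) : ℤ) * (fourier ((m + 1 : ℕ) : ℤ) x : ℂ)‖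
        ≤ R := fun x => by
      rw [norm_mul, norm_fourier_apply, mul_one]
      refine (hd.norm_coeff_le hφ1 (by exact_mod_cast m.succ_ne_zero)).trans ?_
      rw [Int.natAbs_natCast]
      refine le_mul_of_one_le_right (Real.exp_pos _).le (Real.one_le_rpow (by
        exact_mod_cast Nat.le_add_left 1 m) ?_)
      have : 1 / s ≤ 1 := by rw [div_le_one (by linarith)]; exact hs.le
      exact mul_nonneg (by linarith) (by linarith)
    refine (eLpNorm_le_of_ae_bound (ae_of_all _ hb)).trans (le_of_eq ?_)
    rw [AddCircle.measure_univ, ENNReal.toReal_ofReal (by linarith),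
      ENNReal.ofReal_rpow_of_pos (by positivity), ← ENNReal.ofReal_mul (by positivity), hD,
      one_div]

/-! ### Trigonometric polynomials and duality -/

theorem fourierCoeff_sum_mul_fourier {ι : Type*} (S : Finset ι) (m : ι → ℤ) (a : ι → ℂ) (k : ℤ) :
    fourierCoeff (fun x : Circle2Pi => ∑ i ∈ S, a i * (fourier (m i) x : ℂ)) k
      = ∑ i ∈ S, if m i = k then a i else 0 := by
  have h := congrFun (fourierCoeff.sum S (fun i (x : Circle2Pi) => a i * (fourier (m i) x : ℂ))
    fun i _ => (continuous_const.mul (fourier (m i)).continuous).integrable_of_hasCompactSupport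
      (HasCompactSupport.of_compactSpace _)) k
  have e : (fun x : Circle2Pi => ∑ i ∈ S, a i * (fourier (m i) x : ℂ))
      = ∑ i ∈ S, fun x : Circle2Pi => a i * (fourier (m i) x : ℂ) := by
    ext x; simp
  rw [e, h, Finset.sum_apply]
  refine Finset.sum_congr rfl fun i _ => ?_
  rw [fourierCoeff.const_mul, fourierCoeff_fourier]
  by_cases hk : m i = k
  · simp [hk]
  · simp [hk, Ne.symm hk]

theorem fourierCoeff_sub_partialSum {f : Circle2Pi → ℝ} (hf : MemLp f 1 volume) (γ : Finset ℤ)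
    (k : ℤ) :
    fourierCoeff (fun x => (f x : ℂ) - partialSum γ f x) k = if k ∈ γ then 0 else coeff f k := by
  have hi := integrable_ofReal_haarAddCircle hf
  have hP : Integrable (fun x => ∑ k ∈ γ, (-coeff f k) * (fourier k x : ℂ))
      (AddCircle.haarAddCircle : Measure Circle2Pi) :=
    (continuous_sum_fourier γ (fun k => k) _).integrable_of_hasCompactSupport
      (HasCompactSupport.of_compactSpace _)
  have e : (fun x => (f x : ℂ) - partialSum γ f x)
      = (fun x => (f x : ℂ)) + fun x => ∑ k ∈ γ, (-coeff f k) * (fourier k x : ℂ) := by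
    ext x
    simp [partialSum, sub_eq_add_neg]
  rw [e, fourierCoeff.add hi hP, Pi.add_apply,
    fourierCoeff_sum_mul_fourier γ (fun k => k) (fun k => -coeff f k), Finset.sum_ite_eq']
  split_ifs
  · exact add_neg_cancel _
  · exact add_zero _

/-- The sum is the normalised integral of `F` against the polynomial, so Hölder's inequality
applies; the factor `(2π)⁻¹ ≤ 1` is dropped. -/
theorem ofReal_norm_sum_fourierCoeff_le {ι : Type*} (S : Finset ι) (m : ι → ℤ) (a : ι → ℂ)
    {F : Circle2Pi → ℂ} (hF : Integrable F AddCircle.haarAddCircle) {s s' : ℝ}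
    (hss : s.HolderConjugate s') :
    ENNReal.ofReal ‖∑ i ∈ S, a i * fourierCoeff F (m i)‖
      ≤ eLpNorm F (ENNReal.ofReal s) volume *
        eLpNorm (fun x : Circle2Pi => ∑ i ∈ S, a i * (fourier (-m i) x : ℂ))
          (ENNReal.ofReal s') volume := by
  set g : Circle2Pi → ℂ := fun x => ∑ i ∈ S, a i * (fourier (-m i) x : ℂ) with hg
  have hgc : Continuous g := continuous_sum_fourier S (fun i => -m i) a
  have hFm : AEStronglyMeasurable F volume :=
    (MemLp.of_haarAddCircle (memLp_one_iff_integrable.2 hF)).1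
  have e : ∑ i ∈ S, a i * fourierCoeff F (m i) = ∫ x, F x * g x ∂AddCircle.haarAddCircle := by
    have : ∀ x, F x * g x = ∑ i ∈ S, a i * (fourier (-m i) x • F x) := fun x => by
      rw [hg, Finset.mul_sum]
      refine Finset.sum_congr rfl fun i _ => ?_
      rw [smul_eq_mul]; ring
    simp only [this]
    rw [integral_finsetSum _ fun i _ => (hF.fourier_smul (-m i)).const_mul (a i)]
    simp only [integral_const_mul, fourierCoeff]
  rw [e, AddCircle.integral_haarAddCircle, norm_smul]
  have h1 : ‖(2 * π)⁻¹‖ ≤ 1 := by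
    rw [Real.norm_of_nonneg (by positivity)]
    exact inv_le_one_of_one_le₀ (by linarith [Real.pi_gt_three])
  refine (ENNReal.ofReal_le_ofReal (mul_le_of_le_one_left (norm_nonneg _) h1)).trans ?_
  rw [ofReal_norm]
  refine (enorm_integral_le_lintegral_enorm _).trans ?_
  have hs0 := hss.pos
  have hs0' := hss.symm.pos
  rw [eLpNorm_eq_lintegral_rpow_enorm_toReal (by simpa using hs0) ENNReal.ofReal_ne_top,
    eLpNorm_eq_lintegral_rpow_enorm_toReal (by simpa using hs0') ENNReal.ofReal_ne_top,
    ENNReal.toReal_ofReal hs0.le, ENNReal.toReal_ofReal hs0'.le]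
  simp only [enorm_mul]
  exact ENNReal.lintegral_mul_le_Lp_mul_Lq _ hss hFm.enorm hgc.aestronglyMeasurable.enorm

/-- This is the test polynomial for duality. Its coefficients increase, so the last one, `exp(α
N^r)`, governs both the Abel bound and the sum. -/
theorem exists_eLpNorm_exp_pos_kernel_le {α r q : ℝ} (hα : 0 < α) (hr0 : 0 < r) (hr1 : r < 1)
    (hq : 1 < q) :
    ∃ C : ℝ, 0 < C ∧ ∀ (ε : ℤ), (ε = 1 ∨ ε = -1) → ∀ N : ℕ, 1 ≤ N →
      eLpNorm (fun x : Circle2Pi => ∑ k ∈ Finset.range N,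
        (Real.exp (α * ((k + 1 : ℕ) : ℝ) ^ r) : ℂ) * (fourier (-(ε * (k + 1 : ℕ))) x : ℂ))
        (ENNReal.ofReal q) volume
      ≤ ENNReal.ofReal (C * (Real.exp (α * (N : ℝ) ^ r) * (N : ℝ) ^ ((1 - r) * (1 - 1 / q)))) := by
  obtain ⟨C₁, hC₁, h₁⟩ := exists_eLpNorm_le_of_kernel_bound hq
  obtain ⟨C₂, hC₂, h₂⟩ := exists_sum_exp_rpow_le hα hr0 hr1
  refine ⟨C₁ * 2 * C₂ ^ (1 - 1 / q), by positivity, fun ε hε N hN => ?_⟩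
  have hn0 : (0 : ℝ) < N := by exact_mod_cast hN
  obtain ⟨M, rfl⟩ : ∃ M, N = M + 1 := ⟨N - 1, by omega⟩
  set a : ℕ → ℝ := fun k => Real.exp (α * ((k + 1 : ℕ) : ℝ) ^ r) with ha
  have hmono : Monotone a := fun i j hij => by
    simp only [ha, Real.exp_le_exp]
    gcongr
  have hapos : ∀ k, 0 ≤ a k := fun k => (Real.exp_pos _).le
  have hε' : -ε = 1 ∨ -ε = -1 := by rcases hε with rfl | rfl <;> simp
  have hfac : ∀ x : Circle2Pi,
      ‖∑ k ∈ Finset.range (M + 1), (a k : ℂ) * (fourier (-(ε * (k + 1 : ℕ))) x : ℂ)‖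
      = ‖∑ k ∈ Finset.range (M + 1), (a k : ℂ) * (fourier (-ε) x : ℂ) ^ k‖ := fun x => by
    have : ∑ k ∈ Finset.range (M + 1), (a k : ℂ) * (fourier (-(ε * (k + 1 : ℕ))) x : ℂ)
        = (fourier (-ε) x : ℂ) *
          ∑ k ∈ Finset.range (M + 1), (a k : ℂ) * (fourier (-ε) x : ℂ) ^ k := by
      rw [Finset.mul_sum]
      refine Finset.sum_congr rfl fun k _ => ?_
      rw [← neg_mul, fourier_mul_natCast, pow_succ]
      ring
    rw [this, norm_mul, norm_fourier_apply, one_mul]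
  refine (h₁ (-ε) _ (2 * a M) (C₂ * ((M + 1 : ℕ) : ℝ) ^ (1 - r)) hε' (by positivity)
    (by positivity) (fun x => ?_) (fun x => ?_)).trans (ENNReal.ofReal_le_ofReal (le_of_eq ?_))
  · refine (norm_sum_le _ _).trans ?_
    have e : ∀ k, ‖(a k : ℂ) * (fourier (-(ε * (k + 1 : ℕ))) x : ℂ)‖ = a k := fun k => by
      rw [norm_mul, norm_fourier_apply, mul_one, Complex.norm_real, Real.norm_of_nonneg (hapos k)]
    refine (Finset.sum_le_sum fun k _ => (e k).le).trans ?_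
    refine (h₂ (M + 1) hN).trans ?_
    refine mul_le_mul_of_nonneg_right ?_ (by positivity)
    linarith [hapos M, (rfl : a M = Real.exp (α * ((M + 1 : ℕ) : ℝ) ^ r))]
  · rw [hfac]
    exact norm_one_sub_mul_sum_le_of_monotone hmono hapos (norm_fourier_apply (-ε) x) M
  · rw [Real.mul_rpow hC₂.le (by positivity), ← Real.rpow_mul hn0.le]
    ring

/-! ### The Fejér kernel -/

/-- The Fejér kernel `K⁻¹ |∑_{j < K} e^{ijx}|²`. -/
noncomputable def fejer (K : ℕ) (x : Circle2Pi) : ℝ :=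
  ‖∑ j ∈ Finset.range K, (fourier (j : ℤ) x : ℂ)‖ ^ 2 / K

/-- The `k`-th Fourier coefficient of the Fejér kernel. -/
noncomputable def fejerWeight (K : ℕ) (k : ℤ) : ℝ :=
  ((Finset.range K ×ˢ Finset.range K).filter fun p : ℕ × ℕ => (p.1 : ℤ) - p.2 = k).card / K

theorem ofReal_fejer (K : ℕ) (x : Circle2Pi) :
    (fejer K x : ℂ) = ∑ p ∈ Finset.range K ×ˢ Finset.range K,
      (K : ℂ)⁻¹ * (fourier ((p.1 : ℤ) - p.2) x : ℂ) := by
  rw [fejer, Complex.ofReal_div, Complex.ofReal_pow, ← Complex.mul_conj', map_sum,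
    Finset.sum_mul_sum, ← Finset.sum_product', Complex.ofReal_natCast, div_eq_inv_mul,
    Finset.mul_sum]
  refine Finset.sum_congr rfl fun p _ => ?_
  rw [← fourier_neg, ← fourier_add, sub_eq_add_neg]

theorem continuous_fejer (K : ℕ) : Continuous (fejer K) := by
  unfold fejer
  fun_prop

theorem fejer_nonneg (K : ℕ) (x : Circle2Pi) : 0 ≤ fejer K x := by
  unfold fejer
  positivity

theorem coeff_fejer (K : ℕ) (k : ℤ) : coeff (fejer K) k = fejerWeight K k := by
  unfold coeff
  simp only [ofReal_fejer]
  rw [fourierCoeff_sum_mul_fourier _ (fun p : ℕ × ℕ => (p.1 : ℤ) - p.2) (fun _ => (K : ℂ)⁻¹),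
    ← Finset.sum_filter, Finset.sum_const, fejerWeight]
  push_cast
  rw [nsmul_eq_mul, div_eq_mul_inv]

theorem fejerWeight_neg (K : ℕ) (k : ℤ) : fejerWeight K (-k) = fejerWeight K k := by
  unfold fejerWeight
  congr 2
  refine Finset.card_bij (fun p _ => p.swap) ?_ ?_ ?_
  · intro p hp
    simp only [Finset.mem_filter, Finset.mem_product, Prod.fst_swap, Prod.snd_swap] at hp ⊢
    exact ⟨hp.1.symm, by omega⟩
  · intro p _ q _ h
    exact Prod.swap_injective h
  · intro p hp
    simp only [Finset.mem_filter, Finset.mem_product] at hp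
    exact ⟨p.swap, by simp only [Finset.mem_filter, Finset.mem_product, Prod.fst_swap,
      Prod.snd_swap]; exact ⟨hp.1.symm, by omega⟩, by simp⟩

theorem fejerWeight_zero {K : ℕ} (hK : K ≠ 0) : fejerWeight K 0 = 1 := by
  unfold fejerWeight
  have : ((Finset.range K ×ˢ Finset.range K).filter fun p : ℕ × ℕ => (p.1 : ℤ) - p.2 = 0)
      = (Finset.range K).image fun j => (j, j) := by
    ext p
    simp only [Finset.mem_filter, Finset.mem_product, Finset.mem_range, Finset.mem_image,
      Prod.ext_iff]
    constructor
    · rintro ⟨⟨h1, h2⟩, h3⟩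
      exact ⟨p.1, h1, rfl, by omega⟩
    · rintro ⟨j, hj, h1, h2⟩
      exact ⟨⟨by omega, by omega⟩, by omega⟩
  rw [this, Finset.card_image_of_injective _ fun i j h => (Prod.ext_iff.1 h).1, Finset.card_range]
  exact div_self (by exact_mod_cast hK)

theorem fejerWeight_eq_zero {K : ℕ} {k : ℤ} (hk : k ∉ Finset.Icc (-(K : ℤ)) K) :
    fejerWeight K k = 0 := by
  unfold fejerWeight
  rw [Finset.filter_false_of_mem, Finset.card_empty, Nat.cast_zero, zero_div]
  intro p hp h
  rw [Finset.mem_Icc] at hk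
  simp only [Finset.mem_product, Finset.mem_range] at hp
  omega

/-- The `N` pairs `(l + k, l)` with `l < N` already fill half of the normalisation `2N`; this is why
a kernel of order `2N` serves the frequencies up to `N`. -/
theorem half_le_fejerWeight {N k : ℕ} (hk : k ≤ N) (hN : 0 < N) :
    1 / 2 ≤ fejerWeight (2 * N) k := by
  have hcard : N ≤ ((Finset.range (2 * N) ×ˢ Finset.range (2 * N)).filter
      fun p : ℕ × ℕ => (p.1 : ℤ) - p.2 = k).card := by
    have h := Finset.card_le_card_of_injOn (s := Finset.range N)
      (t := (Finset.range (2 * N) ×ˢ Finset.range (2 * N)).filter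
        fun p : ℕ × ℕ => (p.1 : ℤ) - p.2 = k) (fun l => (l + k, l)) (fun l hl => by
          have hl' : l < N := by simpa using hl
          simp only [Finset.coe_filter, Finset.mem_product, Finset.mem_range, Set.mem_ofPred_eq]
          exact ⟨⟨by omega, by omega⟩, by push_cast; ring⟩)
      (fun i _ j _ h => (Prod.ext_iff.1 h).2)
    simpa using h
  unfold fejerWeight
  have hN0 : (0 : ℝ) < N := by exact_mod_cast hN
  rw [le_div_iff₀ (by positivity)]
  push_cast
  have : (N : ℝ) ≤ _ := Nat.cast_le.2 hcard
  linarith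

/-! ### The lower estimate -/

/-- The Fourier coefficients of `extremal`. -/
noncomputable def extremalCoeff (α r β : ℝ) (K : ℕ) (k : ℤ) : ℂ :=
  if k = 0 then 0
  else Complex.exp (Complex.I * ((-(β * π / 2 * (k.sign : ℝ)) : ℝ) : ℂ)) *
    ((Real.exp (-α * (k.natAbs : ℝ) ^ r) * (fejerWeight K k / (4 * π)) : ℝ) : ℂ)

/-- The function whose `(ψ, β)`-derivative is the normalised mean-zero part of the Fejér kernel. -/
noncomputable def extremal (α r β : ℝ) (K : ℕ) (x : Circle2Pi) : ℝ :=
  (∑ k ∈ Finset.Icc (-(K : ℤ)) K, extremalCoeff α r β K k * (fourier k x : ℂ)).re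

/-- This symmetry makes the polynomial real, so the real part in `extremal` discards nothing. -/
theorem conj_extremalCoeff (α r β : ℝ) (K : ℕ) (k : ℤ) :
    (starRingEnd ℂ) (extremalCoeff α r β K k) = extremalCoeff α r β K (-k) := by
  unfold extremalCoeff
  by_cases hk : k = 0
  · simp [hk]
  · rw [if_neg hk, if_neg (neg_ne_zero.2 hk), map_mul, ← Complex.exp_conj, map_mul,
      Complex.conj_ofReal, Complex.conj_ofReal, Complex.conj_I, fejerWeight_neg, Int.natAbs_neg,
      Int.sign_neg]
    congr 2
    push_cast
    ring

theorem ofReal_extremal (α r β : ℝ) (K : ℕ) (x : Circle2Pi) :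
    (extremal α r β K x : ℂ)
      = ∑ k ∈ Finset.Icc (-(K : ℤ)) K, extremalCoeff α r β K k * (fourier k x : ℂ) := by
  unfold extremal
  rw [← Complex.conj_eq_iff_re, map_sum]
  refine Finset.sum_equiv (Equiv.neg ℤ) (fun k => ?_) fun k _ => ?_
  · simp only [Finset.mem_Icc, Equiv.neg_apply]
    omega
  · rw [map_mul, conj_extremalCoeff, ← fourier_neg, Equiv.neg_apply]

theorem coeff_extremal (α r β : ℝ) (K : ℕ) (k : ℤ) :
    coeff (extremal α r β K) k = extremalCoeff α r β K k := by
  unfold coeff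
  simp only [ofReal_extremal]
  rw [fourierCoeff_sum_mul_fourier _ (fun k => k), Finset.sum_ite_eq']
  split_ifs with hk
  · rfl
  · unfold extremalCoeff
    rw [fejerWeight_eq_zero hk]
    simp

theorem memLp_of_continuous {g : Circle2Pi → ℝ} (hg : Continuous g) (p : ℝ≥0∞) :
    MemLp g p volume :=
  hg.memLp_of_hasCompactSupport (HasCompactSupport.of_compactSpace _)

theorem continuous_extremal (α r β : ℝ) (K : ℕ) : Continuous (extremal α r β K) :=
  Complex.continuous_re.comp (continuous_sum_fourier _ (fun k => k) _)

theorem ofReal_integral_eq_coeff_zero (φ : Circle2Pi → ℝ) :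
    ((∫ x, φ x : ℝ) : ℂ) = 2 * π * coeff φ 0 := by
  unfold coeff fourierCoeff
  rw [AddCircle.integral_haarAddCircle]
  have hπ : (π : ℂ) ≠ 0 := by exact_mod_cast Real.pi_ne_zero
  simp only [neg_zero, fourier_zero, one_smul]
  rw [integral_complex_ofReal, Complex.real_smul]
  push_cast
  field_simp

theorem coeff_fejer_sub_one_div {K : ℕ} (hK : K ≠ 0) (k : ℤ) :
    coeff (fun x => (fejer K x - 1) / (4 * π)) k
      = if k = 0 then 0 else ((fejerWeight K k / (4 * π) : ℝ) : ℂ) := by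
  have e : (fun x : Circle2Pi => (((fejer K x - 1) / (4 * π) : ℝ) : ℂ))
      = fun x => (4 * π : ℂ)⁻¹ * (((fun x : Circle2Pi => (fejer K x : ℂ)) +
        fun x : Circle2Pi => ∑ i ∈ ({0} : Finset ℤ), (-1 : ℂ) * (fourier i x : ℂ)) x) := by
    ext x
    rw [Pi.add_apply, Finset.sum_singleton, fourier_zero]
    push_cast
    ring
  have h1 : Integrable (fun x => (fejer K x : ℂ)) (AddCircle.haarAddCircle : Measure Circle2Pi) :=
    integrable_ofReal_haarAddCircle (memLp_of_continuous (continuous_fejer K) 1)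
  have h2 : Integrable (fun x : Circle2Pi => ∑ i ∈ ({0} : Finset ℤ), (-1 : ℂ) * (fourier i x : ℂ))
      AddCircle.haarAddCircle :=
    (continuous_sum_fourier _ (fun k => k) _).integrable_of_hasCompactSupport
      (HasCompactSupport.of_compactSpace _)
  unfold coeff
  rw [e, fourierCoeff.const_mul, fourierCoeff.add h1 h2, Pi.add_apply,
    fourierCoeff_sum_mul_fourier _ (fun k => k), Finset.sum_singleton]
  change (4 * π : ℂ)⁻¹ * (coeff (fejer K) k + _) = _
  rw [coeff_fejer]
  by_cases hk : k = 0
  · subst hk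
    simp [fejerWeight_zero hK]
  · rw [if_neg (Ne.symm hk), if_neg hk]
    push_cast
    ring

/-- The Fejér kernel is nonnegative with integral `2π`, so `fejer - 1` has `L_1` norm at most `4π`,
the normalising constant. -/
theorem extremal_mem_expClass (α r β : ℝ) {K : ℕ} (hK : K ≠ 0) :
    extremal α r β K ∈ expClass α r β 1 := by
  have hc : Continuous fun x => (fejer K x - 1) / (4 * π) :=
    ((continuous_fejer K).sub continuous_const).div_const _
  have hint : ∫ x, fejer K x = 2 * π := by
    have := ofReal_integral_eq_coeff_zero (fejer K)
    rw [coeff_fejer, fejerWeight_zero hK] at this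
    have h2 : ((∫ x, fejer K x : ℝ) : ℂ) = ((2 * π : ℝ) : ℂ) := by rw [this]; push_cast; ring
    exact_mod_cast h2
  refine ⟨memLp_of_continuous (continuous_extremal α r β K) 1,
    fun x => (fejer K x - 1) / (4 * π), ⟨memLp_of_continuous hc 1, fun k => ?_⟩,
    memLp_of_continuous hc 1, ?_, ?_⟩
  · rw [coeff_fejer_sub_one_div hK, coeff_extremal, extremalCoeff]
    by_cases hk : k = 0
    · simp [hk]
    · rw [if_neg hk, if_neg hk, if_neg hk, Complex.ofReal_neg, mul_neg, Complex.exp_neg,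
        Complex.ofReal_mul]
      have h1 : ((Real.exp (-α * (k.natAbs : ℝ) ^ r) : ℝ) : ℂ) ≠ 0 := by
        exact_mod_cast (Real.exp_pos _).ne'
      have h2 := Complex.exp_ne_zero (Complex.I * ((β * π / 2 * (k.sign : ℝ) : ℝ) : ℂ))
      field_simp
      push_cast
      ring
  · rw [eLpNorm_one_eq_lintegral_enorm, ← ofReal_integral_norm_eq_lintegral_enorm
      (memLp_one_iff_integrable.1 (memLp_of_continuous hc 1)), ← ENNReal.ofReal_one]
    refine ENNReal.ofReal_le_ofReal ?_
    have hfi : Integrable (fejer K) volume :=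
      memLp_one_iff_integrable.1 (memLp_of_continuous (continuous_fejer K) 1)
    calc ∫ x, ‖(fejer K x - 1) / (4 * π)‖ ≤ ∫ x, (fejer K x + 1) / (4 * π) := by
          refine integral_mono (memLp_one_iff_integrable.1 (memLp_of_continuous hc 1)).norm
            ((hfi.add (integrable_const 1)).div_const _) fun x => ?_
          rw [norm_div, Real.norm_of_nonneg (by positivity : 0 ≤ 4 * π)]
          gcongr
          rw [Real.norm_eq_abs, abs_le]
          constructor <;> linarith [fejer_nonneg K x]
      _ = 1 := by
          rw [integral_div, integral_add hfi (integrable_const 1), hint, integral_const,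
            Measure.real, AddCircle.measure_univ, ENNReal.toReal_ofReal (by positivity)]
          have := Real.pi_ne_zero
          simp only [smul_eq_mul, mul_one]
          field_simp
          ring
  · have h := ofReal_integral_eq_coeff_zero fun x => (fejer K x - 1) / (4 * π)
    rw [coeff_fejer_sub_one_div hK, if_pos rfl, mul_zero] at h
    exact_mod_cast h

/-- The positive and the nonpositive elements of `γ` are disjoint, so together they hit at most
`γ.card` of the `2N` frequencies. -/
theorem card_range_filter_notMem_add_le (γ : Finset ℤ) (N : ℕ) :
    2 * N ≤ ((Finset.range N).filter fun j : ℕ => 1 * ((j + 1 : ℕ) : ℤ) ∉ γ).card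
      + ((Finset.range N).filter fun j : ℕ => -1 * ((j + 1 : ℕ) : ℤ) ∉ γ).card + γ.card := by
  have h : ∀ ε : ℤ, ((Finset.range N).filter fun j : ℕ => ε * ((j + 1 : ℕ) : ℤ) ∈ γ).card
      + ((Finset.range N).filter fun j : ℕ => ε * ((j + 1 : ℕ) : ℤ) ∉ γ).card = N := fun ε => by
    rw [Finset.card_filter_add_card_filter_not, Finset.card_range]
  have hp : ((Finset.range N).filter fun j : ℕ => 1 * ((j + 1 : ℕ) : ℤ) ∈ γ).card
      ≤ (γ.filter fun k => 0 < k).card := by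
    refine Finset.card_le_card_of_injOn (fun j : ℕ => 1 * ((j + 1 : ℕ) : ℤ)) (fun j hj => ?_)
      fun i _ j _ hij => by simpa using hij
    simp only [Finset.coe_filter, Set.mem_ofPred_eq] at hj ⊢
    exact ⟨hj.2, by omega⟩
  have hn : ((Finset.range N).filter fun j : ℕ => -1 * ((j + 1 : ℕ) : ℤ) ∈ γ).card
      ≤ (γ.filter fun k => ¬ 0 < k).card := by
    refine Finset.card_le_card_of_injOn (fun j : ℕ => -1 * ((j + 1 : ℕ) : ℤ)) (fun j hj => ?_)
      fun i _ j _ hij => by simpa using hij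
    simp only [Finset.coe_filter, Set.mem_ofPred_eq] at hj ⊢
    exact ⟨hj.2, by omega⟩
  have hs := Finset.card_filter_add_card_filter_not (s := γ) fun k : ℤ => 0 < k
  have h1 := h 1
  have h2 := h (-1)
  omega

/-- The weights `exp(α k^r)` cancel `ψ`. Each missed frequency leaves one common phase times a Fejér
weight over `4π`, at least `1/(8π)`, so nothing cancels in the sum. -/
theorem le_norm_sum_fourierCoeff_extremal (α r β : ℝ) {N : ℕ} (hN : 0 < N) (γ : Finset ℤ) {ε : ℤ}
    (hε : ε = 1 ∨ ε = -1) :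
    (((Finset.range N).filter fun j : ℕ => ε * ((j + 1 : ℕ) : ℤ) ∉ γ).card : ℝ) / (8 * π)
      ≤ ‖∑ j ∈ Finset.range N, (Real.exp (α * ((j + 1 : ℕ) : ℝ) ^ r) : ℂ) *
        fourierCoeff (fun x => (extremal α r β (2 * N) x : ℂ)
          - partialSum γ (extremal α r β (2 * N)) x) (ε * (j + 1 : ℕ))‖ := by
  have hterm : ∀ j : ℕ, (Real.exp (α * ((j + 1 : ℕ) : ℝ) ^ r) : ℂ) *
        fourierCoeff (fun x => (extremal α r β (2 * N) x : ℂ)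
          - partialSum γ (extremal α r β (2 * N)) x) (ε * (j + 1 : ℕ))
      = Complex.exp (Complex.I * ((-(β * π / 2 * (ε.sign : ℝ)) : ℝ) : ℂ)) *
        ((if ε * ((j + 1 : ℕ) : ℤ) ∉ γ then
          fejerWeight (2 * N) ((j + 1 : ℕ) : ℤ) / (4 * π) else 0 : ℝ) : ℂ) := fun j => by
    have hpos : (0 : ℤ) < (j + 1 : ℕ) := by exact_mod_cast j.succ_pos
    have hne : ε * (j + 1 : ℕ) ≠ 0 := by
      rcases hε with rfl | rfl <;> omega
    have hw : fejerWeight (2 * N) (ε * (j + 1 : ℕ)) = fejerWeight (2 * N) ((j + 1 : ℕ) : ℤ) := by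
      rcases hε with rfl | rfl
      · rw [one_mul]
      · rw [neg_one_mul, fejerWeight_neg]
    have habs : (ε * (j + 1 : ℕ)).natAbs = j + 1 := by
      rcases hε with rfl | rfl <;> omega
    rw [fourierCoeff_sub_partialSum (memLp_of_continuous (continuous_extremal _ _ _ _) 1),
      coeff_extremal, extremalCoeff, if_neg hne, hw, habs, Int.sign_mul,
      Int.sign_eq_one_of_pos hpos, mul_one]
    by_cases hγ : ε * ((j + 1 : ℕ) : ℤ) ∈ γ
    · rw [if_pos hγ, if_neg (not_not.2 hγ), Complex.ofReal_zero, mul_zero, mul_zero]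
    · rw [if_neg hγ, if_pos hγ, mul_left_comm, ← Complex.ofReal_mul, ← mul_assoc (Real.exp _),
        ← Real.exp_add]
      simp
  simp only [hterm]
  rw [← Finset.mul_sum, norm_mul, norm_exp_I_mul_ofReal, one_mul, ← Complex.ofReal_sum,
    Complex.norm_real, ← Finset.sum_filter]
  refine le_trans ?_ (le_abs_self _)
  rw [div_eq_mul_inv, ← nsmul_eq_mul]
  refine Finset.card_nsmul_le_sum _ _ _ fun j hj => ?_
  have hj' : j < N := Finset.mem_range.1 (Finset.mem_filter.1 hj).1
  have := half_le_fejerWeight (k := j + 1) hj' hN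
  have e : (8 * π)⁻¹ = 1 / 2 / (4 * π) := by field_simp; norm_num
  rw [e]
  gcongr

theorem exists_le_bestOrthClass {α r s s' : ℝ} (β : ℝ) (hα : 0 < α) (hr0 : 0 < r)
    (hr1 : r < 1) (hss : s.HolderConjugate s') :
    ∃ c : ℝ, 0 < c ∧ ∀ n : ℕ, 1 ≤ n → ∀ m : ℕ, m ≤ 2 * n →
      ENNReal.ofReal (c * (Real.exp (-α * (n : ℝ) ^ r) * (n : ℝ) ^ ((1 - r) / s')))
        ≤ bestOrthClass m (expClass α r β 1) (ENNReal.ofReal s) := by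
  obtain ⟨C, hC, hk⟩ := exists_eLpNorm_exp_pos_kernel_le hα hr0 hr1 hss.symm.lt
  have hs0 := hss.pos
  have hs0' := hss.symm.pos
  -- The factor `exp(2αr)` pays for `N^r ≤ n^r + 2r`, and the power of `3` for `N ≤ 3n`.
  set E : ℝ := C * (Real.exp (2 * α * r) * 3 ^ ((1 - r) / s)) with hE
  have hE0 : 0 < E := by positivity
  refine ⟨(8 * π * E)⁻¹, by positivity, fun n hn m hm => ?_⟩
  have hn1 : (1 : ℝ) ≤ n := by exact_mod_cast hn
  have hn0 : (0 : ℝ) < n := by linarith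
  set Y : ℝ := (n : ℝ) ^ (1 - r) with hY
  have hY1 : 1 ≤ Y := Real.one_le_rpow hn1 (by linarith)
  have hYn : Y ≤ n := by
    calc Y ≤ (n : ℝ) ^ (1 : ℝ) := Real.rpow_le_rpow_of_exponent_le hn1 (by linarith)
      _ = n := Real.rpow_one _
  -- The excess over `n` is as long as possible while `exp(α N^r)` stays comparable with `exp(α
  -- n^r)`.
  set M : ℕ := ⌈Y⌉₊ with hM
  have hM1 : Y ≤ M := Nat.le_ceil Y
  have hM2 : (M : ℝ) ≤ 2 * Y := by linarith [Nat.ceil_lt_add_one (by linarith : 0 ≤ Y)]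
  set N : ℕ := n + M with hNdef
  have hN : 0 < N := by omega
  have hNr : (N : ℝ) = n + M := by rw [hNdef]; push_cast; ring
  have hN3 : (N : ℝ) ≤ 3 * n := by linarith
  have hNexp : (N : ℝ) ^ r ≤ (n : ℝ) ^ r + 2 * r := by
    refine (rpow_le_tangent hr0.le hr1.le hn0 (by positivity : (0 : ℝ) ≤ N)).trans ?_
    have e1 : (n : ℝ) ^ (r - 1) * Y = 1 := by
      rw [hY, ← Real.rpow_add hn0]; simp
    have e2 : (n : ℝ) ^ (r - 1) * M ≤ 2 := by
      calc (n : ℝ) ^ (r - 1) * M ≤ (n : ℝ) ^ (r - 1) * (2 * Y) := by gcongr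
        _ = 2 * ((n : ℝ) ^ (r - 1) * Y) := by ring
        _ = 2 := by rw [e1, mul_one]
    rw [hNr, add_sub_cancel_left]
    nlinarith
  have hexp1 : 1 - 1 / s' = 1 / s := by
    have := hss.inv_add_inv_eq_one
    rw [one_div, one_div]; linarith
  set Z : ℝ := Real.exp (α * (n : ℝ) ^ r) * (n : ℝ) ^ ((1 - r) / s) with hZ
  have hZ0 : 0 < Z := by positivity
  have hkN : ∀ ε : ℤ, (ε = 1 ∨ ε = -1) →
      eLpNorm (fun x : Circle2Pi => ∑ k ∈ Finset.range N,
        (Real.exp (α * ((k + 1 : ℕ) : ℝ) ^ r) : ℂ) * (fourier (-(ε * (k + 1 : ℕ))) x : ℂ))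
        (ENNReal.ofReal s') volume ≤ ENNReal.ofReal (E * Z) := fun ε hε => by
    refine (hk ε hε N hN).trans (ENNReal.ofReal_le_ofReal ?_)
    rw [hexp1, hE, hZ, mul_one_div]
    have e1 : Real.exp (α * (N : ℝ) ^ r) ≤ Real.exp (2 * α * r) * Real.exp (α * (n : ℝ) ^ r) := by
      rw [← Real.exp_add, Real.exp_le_exp]
      nlinarith
    have e2 : (N : ℝ) ^ ((1 - r) / s) ≤ 3 ^ ((1 - r) / s) * (n : ℝ) ^ ((1 - r) / s) := by
      rw [← Real.mul_rpow (by norm_num) hn0.le]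
      exact Real.rpow_le_rpow (by positivity) hN3 (div_nonneg (by linarith) hs0.le)
    calc C * (Real.exp (α * (N : ℝ) ^ r) * (N : ℝ) ^ ((1 - r) / s))
        ≤ C * ((Real.exp (2 * α * r) * Real.exp (α * (n : ℝ) ^ r)) *
          (3 ^ ((1 - r) / s) * (n : ℝ) ^ ((1 - r) / s))) := by gcongr
      _ = _ := by ring
  refine le_trans (le_iInf₂ fun γ hγ => ?_)
    (le_iSup₂ (f := fun f _ => bestOrth m f (ENNReal.ofReal s)) (extremal α r β (2 * N))
      (extremal_mem_expClass α r β (by omega)))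
  set F : Circle2Pi → ℂ := fun x => (extremal α r β (2 * N) x : ℂ)
    - partialSum γ (extremal α r β (2 * N)) x with hF
  have hFi : Integrable F AddCircle.haarAddCircle :=
    (integrable_ofReal_haarAddCircle (memLp_of_continuous (continuous_extremal _ _ _ _) 1)).sub
      ((continuous_sum_fourier γ (fun k => k) _).integrable_of_hasCompactSupport
        (HasCompactSupport.of_compactSpace _))
  have hdual : ∀ ε : ℤ, (ε = 1 ∨ ε = -1) →
      ENNReal.ofReal ((((Finset.range N).filter
        fun j : ℕ => ε * ((j + 1 : ℕ) : ℤ) ∉ γ).card : ℝ) / (8 * π))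
      ≤ eLpNorm F (ENNReal.ofReal s) volume * ENNReal.ofReal (E * Z) := fun ε hε =>
    (ENNReal.ofReal_le_ofReal (le_norm_sum_fourierCoeff_extremal α r β hN γ hε)).trans
      ((ofReal_norm_sum_fourierCoeff_le (Finset.range N) (fun j : ℕ => ε * (j + 1 : ℕ))
        (fun j => (Real.exp (α * ((j + 1 : ℕ) : ℝ) ^ r) : ℂ)) hFi hss).trans
        (mul_le_mul' le_rfl (hkN ε hε)))
  have hcard := card_range_filter_notMem_add_le γ N
  -- At least `2N - m ≥ 2M` signed frequencies are missed, so one sign misses at least `M`.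
  have hlarge : ∃ ε : ℤ, (ε = 1 ∨ ε = -1) ∧
      M ≤ ((Finset.range N).filter fun j : ℕ => ε * ((j + 1 : ℕ) : ℤ) ∉ γ).card := by
    by_contra! h
    have h1 := h 1 (Or.inl rfl)
    have h2 := h (-1) (Or.inr rfl)
    omega
  obtain ⟨ε, hε, hMε⟩ := hlarge
  have hfin : ENNReal.ofReal (Y / (8 * π))
      ≤ eLpNorm F (ENNReal.ofReal s) volume * ENNReal.ofReal (E * Z) := by
    refine le_trans (ENNReal.ofReal_le_ofReal ?_) (hdual ε hε)
    have : (M : ℝ) ≤ _ := Nat.cast_le.2 hMε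
    gcongr
    linarith
  have hid : (8 * π * E)⁻¹ * (Real.exp (-α * (n : ℝ) ^ r) * (n : ℝ) ^ ((1 - r) / s'))
      = Y / (8 * π) / (E * Z) := by
    have e1 : (n : ℝ) ^ ((1 - r) / s') * (n : ℝ) ^ ((1 - r) / s) = Y := by
      rw [← Real.rpow_add hn0, hY]
      congr 1
      have := hss.inv_add_inv_eq_one
      rw [div_eq_mul_inv, div_eq_mul_inv, ← mul_add, add_comm, this, mul_one]
    rw [hZ, ← e1, neg_mul, Real.exp_neg]
    field_simp
  rw [hid, ENNReal.ofReal_div_of_pos (by positivity)]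
  exact ENNReal.div_le_of_le_mul hfin

end OrthApprox

theorem corollary2 (r α s s' β : ℝ) (hr0 : 0 < r) (hr1 : r < 1) (hα : 0 < α) (hs : 1 < s)
    (hss' : 1 / s + 1 / s' = 1) :
    OrthApprox.SameOrder
      (fun n => OrthApprox.bestOrthClass (2 * n - 1) (OrthApprox.expClass α r β 1)
        (ENNReal.ofReal s))
      (fun n => OrthApprox.bestOrthClass (2 * n) (OrthApprox.expClass α r β 1)
        (ENNReal.ofReal s)) ∧
    OrthApprox.SameOrder
      (fun n => OrthApprox.bestOrthClass (2 * n) (OrthApprox.expClass α r β 1)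
        (ENNReal.ofReal s))
      (fun n => ENNReal.ofReal
        (Real.exp (-α * (n : ℝ) ^ r) * (n : ℝ) ^ ((1 - r) / s'))) := by
  have hss : s.HolderConjugate s' :=
    Real.holderConjugate_iff.2 ⟨hs, by simpa [one_div] using hss'⟩
  obtain ⟨C, hC, hup⟩ := OrthApprox.exists_bestOrth_le β hα hr0 hr1 hs
  obtain ⟨c, hc, hlow⟩ := OrthApprox.exists_le_bestOrthClass β hα hr0 hr1 hss
  have hexp : (1 - r) * (1 - 1 / s) = (1 - r) / s' := by
    rw [show 1 - 1 / s = 1 / s' by linarith, mul_one_div]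
  rw [hexp] at hup
  have scale : ∀ a b x : ℝ, 0 < a → 0 < b → ENNReal.ofReal (a * x)
      = ((a / b).toNNReal : ℝ≥0∞) * ENNReal.ofReal (b * x) := fun a b x ha hb => by
    change _ = ENNReal.ofReal (a / b) * _
    rw [← ENNReal.ofReal_mul (by positivity)]
    congr 1
    field_simp
  -- All three quantities lie between multiples of the same rate `x`, so the constants are quotients
  -- of those multiples; for the rate itself the multiple is `1`.
  have compare : ∀ {a b : ℝ} {x : ℝ} {u v : ℝ≥0∞}, 0 < a → 0 < b → u ≤ ENNReal.ofReal (b * x) →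
      ENNReal.ofReal (a * x) ≤ v → ((a / b).toNNReal : ℝ≥0∞) * u ≤ v := fun ha hb hu hv =>
    (mul_le_mul' le_rfl hu).trans ((scale _ _ _ ha hb).symm.le.trans hv)
  have compare' : ∀ {a b : ℝ} {x : ℝ} {u v : ℝ≥0∞}, 0 < a → 0 < b → u ≤ ENNReal.ofReal (b * x) →
      ENNReal.ofReal (a * x) ≤ v → u ≤ ((b / a).toNNReal : ℝ≥0∞) * v := fun ha hb hu hv =>
    hu.trans ((scale _ _ _ hb ha).le.trans (mul_le_mul' le_rfl hv))
  refine ⟨⟨(c / C).toNNReal, (C / c).toNNReal, Real.toNNReal_pos.2 (by positivity),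
    Real.toNNReal_pos.2 (by positivity), fun n hn => ⟨?_, ?_⟩⟩,
    ⟨(1 / C).toNNReal, (1 / c).toNNReal, Real.toNNReal_pos.2 (by positivity),
    Real.toNNReal_pos.2 (by positivity), fun n hn => ⟨?_, ?_⟩⟩⟩
  · exact compare hc hC (hup n hn).1 (hlow n hn _ le_rfl)
  · exact compare' hc hC (hup n hn).2 (hlow n hn _ (by omega))
  · exact compare one_pos hC (hup n hn).2 (by rw [one_mul])
  · exact compare' hc one_pos (by rw [one_mul]) (hlow n hn _ le_rfl)
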